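/- Let $m,n,k$ be non-negative integers with $k\le n$. An $(m,n,k)$-Gog trapezoid is an array $M=(m_{i,j})$ of positive integers, indexed by the pairs $(i,j)$ with $1\le i\le n$ and $1\le j\le \min(i,k)$, such that (whenever the entries involved exist) $$m_{i+1,j}\le m_{i,j},\qquad m_{i,j}\le m_{i+1,j+1},\qquad m_{i,j}<m_{i,j+1},\qquad m_{i,j}\le m+(n-i+j).$$ Put $\operatorname{inv}(M)=\#\{(i,j): m_{i,j}=m_{i+1,j+1}\}$ and $\operatorname{inv}'(M)=\#\{(i,j): m_{i,j}=m_{i+1,j}\}$, where only pairs for which both entries belong to the array are counted. Let $b_1<b_2<\dots<b_k$ be positive integers with $b_i\le m+i$ for $1\le i\le k$. Then the generating function $$\sum_{M} u^{\operatorname{inv}(M)}v^{\operatorname{inv}'(M)}$$ over all $(m,n,k)$-Gog trapezoids $M$ with bottom row $(m_{n,1},\dots,m_{n,k})=(b_1,\dots,b_k)$ is equal to the constant term in $x_1,\dots,x_n$ of $$\prod_{i=1}^{k}(1+x_i)^{b_i}x_i^{-n+1}\prod_{i=k+1}^{n}(1+x_i)^{m+i+1}(1+ux_i)^{k-i}x_i^{-n+i-k}\prod_{1\le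 i<j\le n}(x_i-x_j)\bigl(1+(1-v)x_i+u(x_j+x_ix_j)\bigr),$$ where the negative powers $(1+ux_i)^{k-i}$ are expanded as power series in $x_i$ with non-negative exponents. For $k=0$ the empty array is counted once, with weight $1$. -/

import Mathlib

/-- Multivariate Laurent series over `R` in variables indexed by `σ`: formal sums of monomials
`∏ x_s ^ e_s` with integer exponents, whose supports are partially well-ordered for the
componentwise order. For finitely many variables this ring contains all Laurent polynomials and
all power series in non-negative powers of the variables. -/
abbrev MvLaurentSeries (σ R : Type*) [CommRing R] : Type _ :=
  HahnSeries (σ →₀ ℤ) R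

namespace MvLaurentSeries

variable {σ R : Type*} [CommRing R]

/-- The constant term: the coefficient of the monomial all of whose exponents are `0`. -/
def constantTerm (f : MvLaurentSeries σ R) : R :=
  f.coeff 0

/-- The variable `x_s`, as an invertible Laurent series, so that `varX s ^ e` makes sense for
`e : ℤ`. -/
noncomputable def varX (s : σ) : (MvLaurentSeries σ R)ˣ where
  val := HahnSeries.single (Finsupp.single s 1) 1
  inv := HahnSeries.single (Finsupp.single s (-1)) 1
  val_inv := by
    rw [HahnSeries.single_mul_single, ← Finsupp.single_add]; simp
  inv_val := by
    rw [HahnSeries.single_mul_single, ← Finsupp.single_add]; simp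

/-- The ring homomorphism `R⟦X⟧ → MvLaurentSeries σ R` that substitutes `x_s` for `X`. -/
noncomputable def ofPowerSeriesAt (s : σ) : PowerSeries R →+* MvLaurentSeries σ R :=
  (HahnSeries.embDomainRingHom
    ((Finsupp.singleAddHom s).comp (Nat.castAddMonoidHom ℤ))
    (fun a b h => by
      have h' := DFunLike.congr_fun h s
      simpa using h')
    (fun a b => by simp)).comp
  (HahnSeries.toPowerSeries (R := R)).symm.toRingHom

/-- `1 + u X` as an invertible power series; its inverse is the geometric series
`∑ d, (-u) ^ d X ^ d`. -/
noncomputable def onePlusUnit (u : R) : (PowerSeries R)ˣ where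
  val := 1 + PowerSeries.C u * PowerSeries.X
  inv := PowerSeries.mk fun d => (-u) ^ d
  val_inv := by
    ext d
    cases d with
    | zero => simp [add_mul, mul_assoc]
    | succ d => simp [add_mul, mul_assoc, PowerSeries.coeff_succ_X_mul, PowerSeries.coeff_one,
        pow_succ]; ring
  inv_val := by
    rw [mul_comm]
    ext d
    cases d with
    | zero => simp [add_mul, mul_assoc]
    | succ d => simp [add_mul, mul_assoc, PowerSeries.coeff_succ_X_mul, PowerSeries.coeff_one,
        pow_succ]; ring

/-- `1 + u x_s` as an invertible Laurent series; its negative powers are expanded in powers of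
`x_s` with non-negative exponents. -/
noncomputable def onePlus (u : R) (s : σ) : (MvLaurentSeries σ R)ˣ :=
  Units.map (ofPowerSeriesAt s).toMonoidHom (onePlusUnit u)

theorem val_onePlus (u : R) (s : σ) :
    ((onePlus u s : (MvLaurentSeries σ R)ˣ) : MvLaurentSeries σ R) =
      1 + (HahnSeries.C u : MvLaurentSeries σ R) * ((varX s : (MvLaurentSeries σ R)ˣ) :
        MvLaurentSeries σ R) := by
  have hX : (HahnSeries.toPowerSeries (R := R)).symm PowerSeries.X = HahnSeries.single 1 1 := by
    rw [RingEquiv.symm_apply_eq]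
    ext d
    simp [PowerSeries.coeff_X, HahnSeries.coeff_single]
  have hC : (HahnSeries.toPowerSeries (R := R)).symm (PowerSeries.C u) = HahnSeries.C u := by
    rw [RingEquiv.symm_apply_eq]
    ext d
    simp [PowerSeries.coeff_C, HahnSeries.coeff_single, HahnSeries.C_apply]
  simp [onePlus, onePlusUnit, ofPowerSeriesAt, varX, hX, hC, HahnSeries.C_apply]
  refine (HahnSeries.embDomain_single).trans ?_
  simp

end MvLaurentSeries

/-- `(i, j)` is a position of an `(m, n, k)`-Gog trapezoid: row `i` (counted from the top) and
NE-diagonal `j` (counted from the left), where there are `n` rows and `k` NE-diagonals. -/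
def IsGogPos (n k i j : ℕ) : Prop :=
  1 ≤ j ∧ j ≤ i ∧ i ≤ n ∧ j ≤ k

instance (n k i j : ℕ) : Decidable (IsGogPos n k i j) :=
  inferInstanceAs (Decidable (_ ∧ _ ∧ _ ∧ _))

/-- `(m, n, k)`-Gog trapezoids. The positions `(i, j)` and `(i + 1, j)` are consecutive on a
NE-diagonal, `(i, j)` and `(i + 1, j + 1)` are consecutive on a SE-diagonal, and the SE-diagonal
through `(i, j)` is the `(n - i + j)`-th one from the left. Outside the trapezoid the entries are
set to `0`. -/
structure GogTrapezoid (m n k : ℕ) where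
  entry : ℕ → ℕ → ℕ
  entry_pos : ∀ i j, IsGogPos n k i j → 1 ≤ entry i j
  le_northEast : ∀ i j, IsGogPos n k i j → IsGogPos n k (i + 1) j → entry (i + 1) j ≤ entry i j
  le_southEast : ∀ i j, IsGogPos n k i j → IsGogPos n k (i + 1) (j + 1) →
    entry i j ≤ entry (i + 1) (j + 1)
  row_lt : ∀ i j, IsGogPos n k i j → IsGogPos n k i (j + 1) → entry i j < entry i (j + 1)
  le_bound : ∀ i j, IsGogPos n k i j → entry i j ≤ m + ((n - i) + j)
  zeros : ∀ i j, ¬ IsGogPos n k i j → entry i j = 0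

namespace GogTrapezoid

variable {m n k : ℕ}

instance : Finite (GogTrapezoid m n k) := by
  have hb : ∀ (M : GogTrapezoid m n k) (i j : ℕ), M.entry i j < m + n + k + 1 := by
    intro M i j
    by_cases h : IsGogPos n k i j
    · have := M.le_bound i j h
      obtain ⟨_, _, _, _⟩ := h
      omega
    · rw [M.zeros i j h]; omega
  refine Finite.of_injective
    (β := Fin (n + 1) → Fin (k + 1) → Fin (m + n + k + 1))
    (fun M i j => ⟨M.entry i j, hb M i j⟩) ?_
  intro M N h
  have he : M.entry = N.entry := by
    funext i j
    by_cases hp : IsGogPos n k i j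
    · have h' := congrFun (congrFun h ⟨i, Nat.lt_succ_of_le hp.2.2.1⟩)
        ⟨j, Nat.lt_succ_of_le hp.2.2.2⟩
      simpa using h'
    · rw [M.zeros i j hp, N.zeros i j hp]
  cases M; cases N; simp_all

/-- The inversion number: the number of entries that are equal to their SE neighbour. -/
def inv (M : GogTrapezoid m n k) : ℕ :=
  ((Finset.Icc 1 n ×ˢ Finset.Icc 1 k).filter fun p =>
    IsGogPos n k p.1 p.2 ∧ IsGogPos n k (p.1 + 1) (p.2 + 1) ∧
      M.entry p.1 p.2 = M.entry (p.1 + 1) (p.2 + 1)).card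

/-- The complementary inversion number: the number of entries that are equal to their SW
neighbour. -/
def inv' (M : GogTrapezoid m n k) : ℕ :=
  ((Finset.Icc 1 n ×ˢ Finset.Icc 1 k).filter fun p =>
    IsGogPos n k p.1 p.2 ∧ IsGogPos n k (p.1 + 1) p.2 ∧
      M.entry p.1 p.2 = M.entry (p.1 + 1) p.2).card

/-- `M` has bottom row `b 1, …, b k`. -/
def HasBottomRow (M : GogTrapezoid m n k) (b : ℕ → ℕ) : Prop :=
  ∀ j ∈ Finset.Icc 1 k, M.entry n j = b j

noncomputable instance (b : ℕ → ℕ) : Fintype {M : GogTrapezoid m n k // M.HasBottomRow b} :=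
  Fintype.ofFinite _

end GogTrapezoid

/-- The generating function of `(m, n, k)`-Gog trapezoids with bottom row `b 1, …, b k` with
respect to `inv` and `inv'`. -/
noncomputable def gogGenFun (m n k : ℕ) (b : ℕ → ℕ) {R : Type*} [CommRing R] (u v : R) : R :=
  ∑ M : {M : GogTrapezoid m n k // M.HasBottomRow b}, u ^ M.1.inv * v ^ M.1.inv'

open MvLaurentSeries in
/-- The Laurent series in `x_1, …, x_n` whose constant term is taken. -/
noncomputable def gogLaurentSeries (m n k : ℕ) (b : ℕ → ℕ) {R : Type*} [CommRing R] (u v : R) :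
    MvLaurentSeries ℕ R :=
  let x : ℕ → (MvLaurentSeries ℕ R)ˣ := fun i => varX i
  let U : MvLaurentSeries ℕ R := HahnSeries.C u
  let V : MvLaurentSeries ℕ R := HahnSeries.C v
  (∏ i ∈ Finset.Icc 1 k, (1 + (x i : MvLaurentSeries ℕ R)) ^ b i * ↑(x i ^ (-(n : ℤ) + 1))) *
  (∏ i ∈ Finset.Icc (k + 1) n, (1 + (x i : MvLaurentSeries ℕ R)) ^ (m + i + 1) *
    ↑(onePlus u i ^ ((k : ℤ) - i)) * ↑(x i ^ (-(n : ℤ) + i - k))) *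
  ∏ i ∈ Finset.Icc 1 n, ∏ j ∈ Finset.Icc (i + 1) n,
    ((x i : MvLaurentSeries ℕ R) - x j) *
      (1 + (1 - V) * x i + U * (x j + x i * x j))

/-! Both sides satisfy the same recursion in `n`. On the trapezoid side (`gogGenFun_succ`) the
bottom row is removed. This leaves a weighted sum over strictly increasing rows `a` with `β i ≤ a i
≤ β (i + 1)`, where `β` is `bottomSeq`. The parameter `m` grows by one, because the bounds on the
entries count rows from below.

For the constant terms (`boxCoeff_gogFactor_succ`) both sizes are reduced to one alternating sum.

Size `n`, summed over `a`: since `x (1 + x) ^ c` telescopes in `c`, a single entry contributes `r i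
- l i`, with `r i = (1 + u x_i) (1 + x_i) ^ β (i + 1)` and `l i = (1 + (1 - v) x_i) (1 + x_i) ^ β i`
(`u` is replaced by `0` at an entry bounded by the end value `m + k + 2`). Interlacing forces
strictness except when two neighbours both equal `β (j + 1)`, which costs a correction `e j`.
Multiplied by the pair factor of `x_j, x_{j+1}`, the expression `r j * l (j + 1) + e j` becomes `x_j
- x_{j+1}` times a symmetric polynomial, so its coefficient vanishes (`boxCoeff_adjacent_eq_zero`).
Hence no `r` is followed by an `l`, and only `∑_p (-1) ^ p l_0 ⋯ l_{p-1} r_p ⋯ r_{k'-1}` with `k' =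
min k n` survives (`apply_eq_apply_cutSum`).

Size `n + 1`: in every term of `x_0 ⋯ x_n` times the Vandermonde product exactly one variable `x_p`
has exponent `n + 1`, the largest that can contribute. This sets `x_p = 0` everywhere else, and the
pair factors of `x_p` turn into the factors `1 + (1 - v) x_i` of `l` and `1 + u x_i` of `r`
(`boxCoeff_pairProd_succ`). The `p`-th terms then agree. -/

namespace GogTrapezoid

open Finset

/-! ### The coefficient functional: symmetry and elimination of a variable. -/

/-- The `R`-linear functional on polynomials that sends `q` to the coefficient of
`x_0 ^ N ⋯ x_{n-1} ^ N` in `g_0(x_0) ⋯ g_{n-1}(x_{n-1}) q`. -/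
noncomputable def boxCoeff {R : Type*} [CommRing R] (n N : ℕ) (g : ℕ → PowerSeries R) :
    MvPolynomial ℕ R →ₗ[R] R :=
  (MvPolynomial.basisMonomials ℕ R).constr R fun e =>
    ∏ i ∈ range n, PowerSeries.coeff N (PowerSeries.X ^ e i * g i)

variable {R : Type*} [CommRing R]

theorem boxCoeff_monomial (n N : ℕ) (g : ℕ → PowerSeries R) (e : ℕ →₀ ℕ) (c : R) :
    boxCoeff n N g (MvPolynomial.monomial e c) =
      c * ∏ i ∈ range n, PowerSeries.coeff N (PowerSeries.X ^ e i * g i) := by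
  have h : MvPolynomial.monomial e c = c • MvPolynomial.basisMonomials ℕ R e := by
    simp [MvPolynomial.smul_monomial]
  rw [h, map_smul, boxCoeff, Module.Basis.constr_basis, smul_eq_mul]

theorem boxCoeff_congr {n N : ℕ} {g g' : ℕ → PowerSeries R} (h : ∀ i < n, g i = g' i) :
    boxCoeff n N g = boxCoeff n N g' := by
  rw [boxCoeff, boxCoeff]
  congr 1
  funext e
  exact prod_congr rfl fun i hi => by rw [h i (mem_range.1 hi)]

theorem boxCoeff_X_mul (n N : ℕ) (g : ℕ → PowerSeries R) :
    boxCoeff n (N + 1) (fun i => PowerSeries.X * g i) = boxCoeff n N g := by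
  rw [boxCoeff, boxCoeff]
  congr 1
  funext e
  exact prod_congr rfl fun i _ => by rw [mul_left_comm, PowerSeries.coeff_succ_X_mul]

theorem linearMap_ext_monomial {f g : MvPolynomial ℕ R →ₗ[R] R}
    (h : ∀ e, f (MvPolynomial.monomial e 1) = g (MvPolynomial.monomial e 1)) : f = g :=
  (MvPolynomial.basisMonomials ℕ R).ext fun e => by simpa using h e

theorem boxCoeff_rename_swap {n N : ℕ} (g : ℕ → PowerSeries R) {i j : ℕ} (hi : i < n) (hj : j < n)
    (hg : g i = g j) (q : MvPolynomial ℕ R) :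
    boxCoeff n N g (MvPolynomial.rename (Equiv.swap i j) q) = boxCoeff n N g q := by
  suffices h : (boxCoeff n N g) ∘ₗ (MvPolynomial.rename (R := R) (Equiv.swap i j)).toLinearMap =
      boxCoeff n N g from LinearMap.congr_fun h q
  refine linearMap_ext_monomial fun e => ?_
  simp only [LinearMap.comp_apply, AlgHom.toLinearMap_apply, MvPolynomial.rename_monomial,
    boxCoeff_monomial]
  congr 1
  have hgs : ∀ l, g (Equiv.swap i j l) = g l := by
    intro l
    rcases eq_or_ne l i with h | h
    · subst h; simp [hg]
    · rcases eq_or_ne l j with h' | h'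
      · subst h'; simp [hg]
      · rw [Equiv.swap_apply_of_ne_of_ne h h']
  rw [← Equiv.Perm.prod_comp (Equiv.swap i j)]
  · refine prod_congr rfl fun l _ => ?_
    rw [hgs, Finsupp.mapDomain_apply (Equiv.injective _)]
  · intro l hl
    simp only [Finset.coe_range, Set.mem_Iio]
    by_contra hln
    exact hl (Equiv.swap_apply_of_ne_of_ne (by omega) (by omega))

/-- The functional vanishes on `x_i - x_j` times a polynomial symmetric in `x_i` and `x_j`. -/
theorem boxCoeff_X_sub_X_mul {n N : ℕ} (g : ℕ → PowerSeries R) {i j : ℕ} (hi : i < n) (hj : j < n)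
    (hg : g i = g j) {q : MvPolynomial ℕ R} (hq : MvPolynomial.rename (Equiv.swap i j) q = q) :
    boxCoeff n N g ((MvPolynomial.X i - MvPolynomial.X j) * q) = 0 := by
  rw [sub_mul, map_sub, sub_eq_zero, ← boxCoeff_rename_swap g hi hj hg]
  simp [hq]

/-- The `g i` are power series, so an exponent that already exceeds `N` cannot be brought back to
`N`. -/
theorem boxCoeff_X_pow_mul_eq_zero {n N d p : ℕ} (g : ℕ → PowerSeries R) (hp : p < n) (hd : N < d)
    (q : MvPolynomial ℕ R) : boxCoeff n N g (MvPolynomial.X p ^ d * q) = 0 := by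
  suffices h : (boxCoeff n N g) ∘ₗ LinearMap.mulLeft R (MvPolynomial.X p ^ d) = 0 from
    LinearMap.congr_fun h q
  refine linearMap_ext_monomial fun e => ?_
  simp only [LinearMap.comp_apply, LinearMap.mulLeft_apply, MvPolynomial.X_pow_eq_monomial,
    MvPolynomial.monomial_mul, boxCoeff_monomial, LinearMap.zero_apply]
  rw [prod_eq_zero (mem_range.2 hp), mul_zero]
  rw [PowerSeries.coeff_X_pow_mul', if_neg]
  simp; omega

/-- The order embedding `ℕ → ℕ` that misses `p`. -/
def skip (p i : ℕ) : ℕ := if i < p then i else i + 1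

/-- The substitution `x_p = 0`, followed by closing the gap in the numbering of the variables. -/
noncomputable def killVar (R : Type*) [CommRing R] (p : ℕ) :
    MvPolynomial ℕ R →ₐ[R] MvPolynomial ℕ R :=
  MvPolynomial.aeval fun i =>
    if i < p then MvPolynomial.X i else if i = p then 0 else MvPolynomial.X (i - 1)

theorem prod_range_succ_skip {M : Type*} [CommMonoid M] {n p : ℕ} (hp : p ≤ n) (F : ℕ → M) :
    ∏ i ∈ range (n + 1), F i = F p * ∏ i ∈ range n, F (skip p i) := by
  induction n, hp using Nat.le_induction with
  | base =>
    rw [prod_range_succ, mul_comm]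
    congr 1
    exact prod_congr rfl fun i hi => by simp [skip, mem_range.1 hi]
  | succ n hn ih =>
    rw [prod_range_succ, ih, prod_range_succ _ n, mul_assoc]
    congr 3
    simp [skip]; omega

theorem killVar_X_skip (p i : ℕ) :
    killVar R p (MvPolynomial.X (skip p i)) = MvPolynomial.X i := by
  rcases lt_or_ge i p with h | h
  · simp [killVar, skip, h]
  · simp [killVar, skip, Nat.not_lt.2 h, show ¬ i + 1 < p by omega, show ¬ i + 1 = p by omega]

theorem killVar_X_self (p : ℕ) : killVar R p (MvPolynomial.X p) = 0 := by
  simp [killVar]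

/-- The factor `x_p ^ N` exhausts the exponent of `x_p`, so both `g p` and `q` can contribute only
their parts free of `x_p`. -/
theorem boxCoeff_X_pow_mul {n N p : ℕ} (g : ℕ → PowerSeries R) (hp : p ≤ n)
    (q : MvPolynomial ℕ R) :
    boxCoeff (n + 1) N g (MvPolynomial.X p ^ N * q) =
      PowerSeries.constantCoeff (g p) * boxCoeff n N (fun i => g (skip p i)) (killVar R p q) := by
  suffices h : (boxCoeff (n + 1) N g) ∘ₗ LinearMap.mulLeft R (MvPolynomial.X p ^ N) =
      PowerSeries.constantCoeff (g p) •
        ((boxCoeff n N fun i => g (skip p i)) ∘ₗ (killVar R p).toLinearMap) from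
    LinearMap.congr_fun h q
  refine linearMap_ext_monomial fun e => ?_
  simp only [LinearMap.comp_apply, LinearMap.mulLeft_apply, MvPolynomial.X_pow_eq_monomial,
    MvPolynomial.monomial_mul, boxCoeff_monomial, LinearMap.smul_apply, smul_eq_mul,
    AlgHom.toLinearMap_apply, one_mul]
  have hskip : ∀ i, skip p i ≠ p := by intro i; unfold skip; split_ifs <;> omega
  have hinj : Function.Injective (skip p) := by
    intro i j; unfold skip; split_ifs <;> omega
  rw [prod_range_succ_skip hp]
  rcases Nat.eq_zero_or_pos (e p) with h0 | h0
  -- A monomial free of `x_p` comes from a renaming along `skip p`, which `killVar` undoes.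
  · have he : MvPolynomial.monomial e (1 : R) =
        MvPolynomial.rename (skip p)
          (MvPolynomial.monomial (e.comapDomain (skip p) hinj.injOn) 1) := by
      rw [MvPolynomial.rename_monomial, Finsupp.mapDomain_comapDomain _ hinj]
      intro i hi
      have hip : i ≠ p := by rintro rfl; simp_all
      rcases lt_or_gt_of_ne hip with h | h
      · exact ⟨i, by simp [skip, h]⟩
      · exact ⟨i - 1, by simp only [skip]; split_ifs <;> omega⟩
    have hk : ∀ s : MvPolynomial ℕ R, killVar R p (MvPolynomial.rename (skip p) s) = s := by
      intro s
      have : (killVar R p).comp (MvPolynomial.rename (skip p)) = AlgHom.id R _ := by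
        ext i : 1
        simp [killVar_X_skip]
      exact AlgHom.congr_fun this s
    rw [he, hk, boxCoeff_monomial]
    congr 1
    · simp [h0, PowerSeries.coeff_X_pow_mul']
    · rw [one_mul]
      refine prod_congr rfl fun i _ => ?_
      simp [(hskip i).symm]
  · have he : MvPolynomial.monomial e (1 : R) = MvPolynomial.X p *
        MvPolynomial.monomial (e - Finsupp.single p 1) 1 := by
      rw [MvPolynomial.X, MvPolynomial.monomial_mul, one_mul, add_tsub_cancel_of_le]
      simpa [Nat.one_le_iff_ne_zero] using h0.ne'
    rw [he, map_mul (killVar R p), killVar_X_self, zero_mul, map_zero, mul_zero]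
    have : PowerSeries.coeff N
        (PowerSeries.X ^ ((Finsupp.single p N + e : ℕ →₀ ℕ) p) * g p) = 0 := by
      rw [PowerSeries.coeff_X_pow_mul', if_neg]
      simp; omega
    rw [this, zero_mul]

end GogTrapezoid

/-! ### Constant terms of products of one-variable series. -/

namespace MvLaurentSeries

open Finset

variable {R : Type*} [CommRing R]

theorem ofPowerSeriesAt_eq_embDomain {σ : Type*} (s : σ) :
    ∃ f : ℕ ↪o (σ →₀ ℤ), (∀ t : ℕ, f t = Finsupp.single s (t : ℤ)) ∧ ∀ g : PowerSeries R,
      ofPowerSeriesAt s g = HahnSeries.embDomain f (HahnSeries.toPowerSeries.symm g) :=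
  ⟨_, fun _ => rfl, fun _ => rfl⟩

theorem coeff_ofPowerSeriesAt {σ : Type*} (s : σ) (g : PowerSeries R) (t : ℕ) :
    (ofPowerSeriesAt s g).coeff (Finsupp.single s (t : ℤ)) = PowerSeries.coeff t g := by
  obtain ⟨f, hf, h⟩ := ofPowerSeriesAt_eq_embDomain (R := R) s
  rw [h, ← hf, HahnSeries.embDomain_coeff]
  simp

theorem support_ofPowerSeriesAt {σ : Type*} (s : σ) (g : PowerSeries R) :
    (ofPowerSeriesAt s g).support ⊆ Set.range (Finsupp.single s) := by
  obtain ⟨f, hf, h⟩ := ofPowerSeriesAt_eq_embDomain (R := R) s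
  rw [h]
  refine HahnSeries.support_embDomain_subset.trans ?_
  rintro _ ⟨t, -, rfl⟩
  exact ⟨t, (hf t).symm⟩

theorem ofPowerSeriesAt_X {σ : Type*} (s : σ) :
    ofPowerSeriesAt s (PowerSeries.X : PowerSeries R) = (varX s : (MvLaurentSeries σ R)ˣ) := by
  have hX : (HahnSeries.toPowerSeries (R := R)).symm PowerSeries.X = HahnSeries.single 1 1 := by
    rw [RingEquiv.symm_apply_eq]
    ext d
    simp [PowerSeries.coeff_X, HahnSeries.coeff_single]
  obtain ⟨f, hf, h⟩ := ofPowerSeriesAt_eq_embDomain (R := R) s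
  rw [h, hX, HahnSeries.embDomain_single, hf]
  simp [varX]

theorem ofPowerSeriesAt_C {σ : Type*} (s : σ) (r : R) :
    ofPowerSeriesAt s (PowerSeries.C r) = HahnSeries.C r := by
  have hC : (HahnSeries.toPowerSeries (R := R)).symm (PowerSeries.C r) = HahnSeries.C r := by
    rw [RingEquiv.symm_apply_eq]
    ext d
    simp [PowerSeries.coeff_C, HahnSeries.coeff_single, HahnSeries.C_apply]
  obtain ⟨f, hf, h⟩ := ofPowerSeriesAt_eq_embDomain (R := R) s
  rw [h, hC, HahnSeries.C_apply, HahnSeries.embDomain_single, hf]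
  simp

theorem val_varX_zpow {σ : Type*} (s : σ) (t : ℤ) :
    ((varX s ^ t : (MvLaurentSeries σ R)ˣ) : MvLaurentSeries σ R) =
      HahnSeries.single (Finsupp.single s t) 1 := by
  rcases Int.eq_nat_or_neg t with ⟨d, rfl | rfl⟩
  · rw [zpow_natCast, Units.val_pow_eq_pow_val]
    simp [varX]
  · rw [zpow_neg, zpow_natCast, ← inv_pow, Units.val_pow_eq_pow_val]
    simp [varX]

theorem constantTerm_varX_zpow_mul {σ : Type*} (s : σ) (N : ℕ) (g : PowerSeries R) :
    ((varX s ^ (-(N : ℤ)) : (MvLaurentSeries σ R)ˣ) * ofPowerSeriesAt s g).constantTerm =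
      PowerSeries.coeff N g := by
  have h := HahnSeries.coeff_single_mul_add (r := (1 : R)) (x := ofPowerSeriesAt s g)
    (a := Finsupp.single s (N : ℤ)) (b := Finsupp.single s (-(N : ℤ)))
  rw [← Finsupp.single_add, add_neg_cancel, Finsupp.single_zero, one_mul,
    coeff_ofPowerSeriesAt] at h
  rw [constantTerm, val_varX_zpow, h]

theorem support_varX_zpow_mul {σ : Type*} (s : σ) (t : ℤ) (g : PowerSeries R) :
    ((varX s ^ t : (MvLaurentSeries σ R)ˣ) * ofPowerSeriesAt s g).support ⊆
      Set.range (Finsupp.single s) := by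
  refine HahnSeries.support_mul_subset.trans ?_
  rw [val_varX_zpow]
  rintro _ ⟨a, ha, c, hc, rfl⟩
  obtain rfl := HahnSeries.support_single_subset ha
  obtain ⟨d, rfl⟩ := support_ofPowerSeriesAt s g hc
  exact ⟨t + d, Finsupp.single_add _ _ _⟩

/-- The constant term is multiplicative on series in disjoint sets of variables. -/
theorem constantTerm_mul {σ : Type*} {s : σ} {A B : MvLaurentSeries σ R}
    (hA : A.support ⊆ {e | e s = 0}) (hB : B.support ⊆ Set.range (Finsupp.single s)) :
    (A * B).constantTerm = A.constantTerm * B.constantTerm := by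
  rw [constantTerm, HahnSeries.coeff_mul, constantTerm, constantTerm]
  have key : ∀ x : (σ →₀ ℤ) × (σ →₀ ℤ), x.1 ∈ A.support → x.2 ∈ B.support → x.1 + x.2 = 0 →
      x = (0, 0) := by
    rintro ⟨a, c⟩ ha hc hac
    obtain ⟨t, rfl⟩ := hB hc
    have h1 : a s = 0 := hA ha
    have h2 := DFunLike.congr_fun hac s
    simp [h1] at h2
    subst h2
    simpa using hac
  by_cases h : (0 : σ →₀ ℤ) ∈ A.support ∧ (0 : σ →₀ ℤ) ∈ B.support
  · rw [sum_eq_single ((0, 0) : (σ →₀ ℤ) × (σ →₀ ℤ))]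
    · intro x hx hne
      rw [Finset.mem_antidiagonal] at hx
      exact absurd (key x hx.1 hx.2.1 hx.2.2) hne
    · intro hx
      simp only [Finset.mem_antidiagonal, add_zero, and_true] at hx
      exact absurd h hx
  · rw [sum_eq_zero]
    · rw [not_and_or, HahnSeries.mem_support, HahnSeries.mem_support, not_not, not_not] at h
      rcases h with h | h <;> simp [h]
    · intro x hx
      rw [Finset.mem_antidiagonal] at hx
      have := key x hx.1 hx.2.1 hx.2.2
      subst this
      exact absurd ⟨hx.1, hx.2.1⟩ h

theorem support_prod_subset {σ ι : Type*} (S : Finset ι) (s : σ) (A : ι → MvLaurentSeries σ R)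
    (hA : ∀ i ∈ S, (A i).support ⊆ {e | e s = 0}) : (∏ i ∈ S, A i).support ⊆ {e | e s = 0} := by
  classical
  induction S using Finset.induction_on with
  | empty =>
    rw [prod_empty, ← HahnSeries.single_zero_one]
    intro e he
    obtain rfl := HahnSeries.support_single_subset he
    rfl
  | insert i S hi ih =>
    rw [prod_insert hi]
    refine HahnSeries.support_mul_subset.trans ?_
    rintro _ ⟨a, ha, c, hc, rfl⟩
    have h1 : a s = 0 := hA i (mem_insert_self i S) ha
    have h2 : c s = 0 := ih (fun j hj => hA j (mem_insert_of_mem hj)) hc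
    simp [h1, h2]

theorem constantTerm_prod (n N : ℕ) (g : ℕ → PowerSeries R) :
    (∏ i ∈ range n, ((varX (i + 1) ^ (-(N : ℤ)) : (MvLaurentSeries ℕ R)ˣ) *
      ofPowerSeriesAt (i + 1) (g i))).constantTerm = ∏ i ∈ range n, PowerSeries.coeff N (g i) := by
  induction n with
  | zero => simp [constantTerm]
  | succ n ih =>
    rw [prod_range_succ, prod_range_succ, ← ih, constantTerm_mul (s := n + 1),
      constantTerm_varX_zpow_mul]
    · refine support_prod_subset _ _ _ fun i hi => (support_varX_zpow_mul _ _ _).trans ?_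
      rintro _ ⟨t, rfl⟩
      exact Finsupp.single_eq_of_ne (by have := mem_range.1 hi; omega)
    · exact support_varX_zpow_mul _ _ _

end MvLaurentSeries

/-! ### The coefficient functional as a constant term. -/

namespace GogTrapezoid

open Finset MvLaurentSeries

variable {R : Type*} [CommRing R]

/-- The substitution of `x_{i+1}` for the `i`-th variable, `i < n`, and of `1` for the others. -/
noncomputable def toLaurent (R : Type*) [CommRing R] (n : ℕ) :
    MvPolynomial ℕ R →ₐ[R] MvLaurentSeries ℕ R :=
  MvPolynomial.aeval fun i =>
    if i < n then ((varX (i + 1) : (MvLaurentSeries ℕ R)ˣ) : MvLaurentSeries ℕ R) else 1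

/-- Variables of index at least `n` go to `1` under `toLaurent`, in accordance with `boxCoeff`,
which ignores their exponents. -/
theorem boxCoeff_eq_constantTerm (n N : ℕ) (g : ℕ → PowerSeries R) (q : MvPolynomial ℕ R) :
    boxCoeff n N g q = ((∏ i ∈ range n, ((varX (i + 1) ^ (-(N : ℤ)) : (MvLaurentSeries ℕ R)ˣ) *
      ofPowerSeriesAt (i + 1) (g i))) * toLaurent R n q).constantTerm := by
  induction q using MvPolynomial.induction_on' with
  | monomial e c =>
    have h : toLaurent R n (MvPolynomial.monomial e c) = HahnSeries.C c *
        ∏ i ∈ range n, ofPowerSeriesAt (i + 1) (PowerSeries.X ^ e i) := by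
      rw [toLaurent, MvPolynomial.aeval_monomial, HahnSeries.algebraMap_apply]
      congr 1
      rw [Finsupp.prod_of_support_subset e (s := e.support ∪ range n) subset_union_left _ (by simp),
        ← prod_subset (s₁ := range n) subset_union_right]
      · refine prod_congr rfl fun i hi => ?_
        rw [if_pos (mem_range.1 hi), map_pow, ofPowerSeriesAt_X]
      · intro i _ hi
        rw [if_neg (by simpa using hi), one_pow]
    rw [boxCoeff_monomial, h, mul_left_comm, ← prod_mul_distrib, HahnSeries.C_mul_eq_smul,
      constantTerm, HahnSeries.coeff_smul, smul_eq_mul, ← constantTerm_prod]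
    simp only [map_mul, constantTerm]
    congr 3
    funext i
    ring
  | add p q hp hq => rw [map_add, map_add, mul_add, hp, hq]; simp [constantTerm]

/-- One-variable polynomial factors move between the argument and the series `g`; in the Laurent
ring this is mere regrouping. -/
theorem boxCoeff_prod_aeval_mul (n N : ℕ) (g : ℕ → PowerSeries R) (p : ℕ → Polynomial R)
    (q : MvPolynomial ℕ R) :
    boxCoeff n N g ((∏ i ∈ range n, Polynomial.aeval (MvPolynomial.X i) (p i)) * q) =
      boxCoeff n N (fun i => (p i : PowerSeries R) * g i) q := by
  rw [boxCoeff_eq_constantTerm, boxCoeff_eq_constantTerm, map_mul, map_prod, ← mul_assoc,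
    ← prod_mul_distrib]
  congr 2
  refine prod_congr rfl fun i hi => ?_
  have h : toLaurent R n (Polynomial.aeval (MvPolynomial.X i) (p i)) =
      ofPowerSeriesAt (i + 1) (p i : PowerSeries R) := by
    induction p i using Polynomial.induction_on' with
    | add p q hp hq => simp [hp, hq]
    | monomial d c =>
      simp only [← Polynomial.C_mul_X_pow_eq_monomial, map_mul, map_pow, Polynomial.aeval_X,
        Polynomial.aeval_C, Polynomial.coe_mul, Polynomial.coe_pow, Polynomial.coe_X,
        Polynomial.coe_C, ofPowerSeriesAt_X, ofPowerSeriesAt_C, AlgHom.commutes]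
      rw [HahnSeries.algebraMap_apply, toLaurent, MvPolynomial.aeval_X,
        if_pos (mem_range.1 hi)]
      simp
  rw [h, map_mul]
  ring

/-! ### Extraction of the variable of top exponent from a Vandermonde product. -/

/-- In the Leibniz expansion the factor `y p ^ (n + 1)` annihilates every term in which `y p`
already occurs. The remaining terms have `p = σ 0`; there the exponents `0, 1, …, n` have become `n
+ 1, 1, …, n`, which is the expansion of `∏ y i` times the determinant up to a cyclic shift of sign
`(-1) ^ n`. -/
theorem sum_boxCoeff_pow_mul_det (n : ℕ) (g : ℕ → PowerSeries R) (y : Fin (n + 1) → MvPolynomial ℕ R)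
    (hy : ∀ i, y i = -MvPolynomial.X (i : ℕ)) (K : MvPolynomial ℕ R) :
    ∑ p, boxCoeff (n + 1) (n + 1) g (y p ^ (n + 1) * (Matrix.vandermonde y).det * K) =
      (-1) ^ n * boxCoeff (n + 1) (n + 1) g ((∏ i, y i) * (Matrix.vandermonde y).det * K) := by
  set L := boxCoeff (n + 1) (n + 1) g
  have hε : ∀ (σ : Equiv.Perm (Fin (n + 1))) (q : MvPolynomial ℕ R),
      L (((Equiv.Perm.sign σ : ℤ) : MvPolynomial ℕ R) * q) = (Equiv.Perm.sign σ : ℤ) * L q := by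
    intro σ q
    rw [← zsmul_eq_mul, map_zsmul, zsmul_eq_mul]
  have hzero : ∀ (p : Fin (n + 1)) (d : ℕ) (q : MvPolynomial ℕ R), n + 1 < d →
      L (y p ^ d * q) = 0 := by
    intro p d q hd
    rw [hy, neg_pow, mul_assoc, mul_left_comm]
    exact boxCoeff_X_pow_mul_eq_zero g p.2 hd _
  have hsum : ∀ σ : Equiv.Perm (Fin (n + 1)),
      ∑ p, L (y p ^ (n + 1) * (∏ i : Fin (n + 1), y (σ i) ^ (i : ℕ)) * K) =
        L ((∏ i : Fin (n + 1), y ((σ * finRotate (n + 1)) i) ^ ((i : ℕ) + 1)) * K) := by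
    intro σ
    rw [sum_eq_single (σ 0)]
    · congr 2
      rw [Fin.prod_univ_succ, Fin.prod_univ_castSucc]
      simp [mul_comm]
    · intro p _ hp
      rw [← mul_prod_erase univ _ (mem_univ (σ.symm p)), ← mul_assoc, Equiv.apply_symm_apply,
        ← pow_add, mul_assoc]
      refine hzero _ _ _ ?_
      have : (σ.symm p) ≠ 0 := by
        intro h; apply hp; rw [← h, Equiv.apply_symm_apply]
      have := Fin.pos_iff_ne_zero.2 this
      have : 0 < ((σ.symm p : Fin (n + 1)) : ℕ) := this
      omega
    · simp
  have hdet : (Matrix.vandermonde y).det = ∑ σ : Equiv.Perm (Fin (n + 1)),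
      ((Equiv.Perm.sign σ : ℤ) : MvPolynomial ℕ R) * ∏ i : Fin (n + 1), y (σ i) ^ (i : ℕ) := by
    rw [Matrix.det_apply']; rfl
  have hR : ∀ σ : Equiv.Perm (Fin (n + 1)), (∏ i, y i) * (∏ i : Fin (n + 1), y (σ i) ^ (i : ℕ)) =
      ∏ i : Fin (n + 1), y (σ i) ^ ((i : ℕ) + 1) := by
    intro σ
    rw [← Equiv.prod_comp σ y, ← prod_mul_distrib]
    exact prod_congr rfl fun i _ => by rw [pow_succ, mul_comm]
  have hl : ∀ (a q : MvPolynomial ℕ R) (σ : Equiv.Perm (Fin (n + 1))),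
      a * (((Equiv.Perm.sign σ : ℤ) : MvPolynomial ℕ R) * q) * K =
        ((Equiv.Perm.sign σ : ℤ) : MvPolynomial ℕ R) * (a * q * K) := by
    intros; ring
  simp_rw [hdet, mul_sum, sum_mul, map_sum, hl, hε, hR]
  rw [sum_comm]
  simp_rw [← mul_sum, hsum]
  rw [mul_sum]
  -- Reindexing by `σ ↦ σ * finRotate (n + 1)` absorbs the cyclic shift of the exponents.
  refine Fintype.sum_equiv (Equiv.mulRight (finRotate (n + 1))) _ _ fun σ => ?_
  simp only [Equiv.coe_mulRight, Equiv.Perm.sign_mul, sign_finRotate]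
  push_cast
  have hun : (-1 : R) ^ n * (-1) ^ n = 1 := by rw [← mul_pow]; simp
  rw [← mul_assoc, mul_left_comm, hun, mul_one]

/-- The Vandermonde product `∏_{i < j < n} (x_i - x_j)`. -/
noncomputable def vandermondeProd (R : Type*) [CommRing R] (n : ℕ) : MvPolynomial ℕ R :=
  ∏ j ∈ range n, ∏ i ∈ range j, (MvPolynomial.X i - MvPolynomial.X j)

/-- The nodes are negated because the determinant is a product of later minus earlier nodes, the
opposite of `x_i - x_j`. -/
theorem vandermondeProd_eq_det (n : ℕ) :
    vandermondeProd R n =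
      (Matrix.vandermonde fun i : Fin n => -(MvPolynomial.X (i : ℕ) : MvPolynomial ℕ R)).det := by
  rw [Matrix.det_vandermonde, vandermondeProd, prod_range]
  rw [prod_comm' (t' := univ) (s' := fun j => Iio j) (by simp)]
  refine prod_congr rfl fun j _ => ?_
  symm
  refine prod_nbij (fun i => (i : ℕ)) ?_ ?_ ?_ ?_
  · intro i hi; simpa using hi
  · intro i _ j _ h; exact Fin.ext h
  · intro i hi
    have hi' : i < j := by simpa using hi
    exact ⟨⟨i, hi'.trans j.2⟩, by simpa [Fin.lt_def] using hi', rfl⟩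
  · intro i _; ring

theorem boxCoeff_prod_X_mul_vandermondeProd (n : ℕ) (g : ℕ → PowerSeries R)
    (K : MvPolynomial ℕ R) :
    boxCoeff (n + 1) (n + 1) g
        ((∏ i ∈ range (n + 1), MvPolynomial.X i) * (vandermondeProd R (n + 1) * K)) =
      (-1) ^ n * ∑ p ∈ range (n + 1), boxCoeff (n + 1) (n + 1) g
        (MvPolynomial.X p ^ (n + 1) * (vandermondeProd R (n + 1) * K)) := by
  have h := sum_boxCoeff_pow_mul_det n g
    (fun i => -(MvPolynomial.X (i : ℕ) : MvPolynomial ℕ R)) (fun _ => rfl) K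
  rw [← vandermondeProd_eq_det] at h
  have hneg : ∀ q : MvPolynomial ℕ R, (-1 : MvPolynomial ℕ R) ^ (n + 1) * q =
      ((-1 : R) ^ (n + 1)) • q := by
    intro q
    rw [MvPolynomial.smul_eq_C_mul]; simp
  have hun : (-1 : R) ^ (n + 1) * (-1) ^ (n + 1) = 1 := by rw [← mul_pow]; simp
  have hun' : (-1 : R) ^ n * (-1) ^ n = 1 := by rw [← mul_pow]; simp
  have hp : ∏ i : Fin (n + 1), -(MvPolynomial.X (i : ℕ) : MvPolynomial ℕ R) =
      (-1) ^ (n + 1) * ∏ i ∈ range (n + 1), MvPolynomial.X i := by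
    rw [prod_neg, prod_range]; simp
  simp_rw [hp, neg_pow (MvPolynomial.X _ : MvPolynomial ℕ R), mul_assoc, hneg, map_smul,
    smul_eq_mul] at h
  rw [← mul_sum, mul_left_comm] at h
  have h' := congrArg (fun z => (-1 : R) ^ n * ((-1) ^ (n + 1) * z)) h
  rw [← mul_assoc ((-1 : R) ^ (n + 1)), hun, one_mul, ← mul_assoc ((-1 : R) ^ (n + 1)), hun,
    one_mul, ← mul_assoc ((-1 : R) ^ n), hun', one_mul] at h'
  rw [← h', sum_range]

/-! ### The product over pairs and the expansion over an eliminated variable. -/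

/-- The bivariate factor `(x - y) (1 + (1 - v) x + u (y + x y))`. -/
def pairFactor {A : Type*} [CommRing A] (u v x y : A) : A :=
  (x - y) * (1 + (1 - v) * x + u * (y + x * y))

/-- The product of the factors `(x_i - x_j) (1 + (1 - v) x_i + u (x_j + x_i x_j))`,
`i < j < n`. -/
noncomputable def pairProd (n : ℕ) (u v : R) : MvPolynomial ℕ R :=
  ∏ j ∈ range n, ∏ i ∈ range j,
    pairFactor (MvPolynomial.C u) (MvPolynomial.C v) (MvPolynomial.X i) (MvPolynomial.X j)

theorem prod_pairs_skip {M : Type*} [CommMonoid M] (F : ℕ → ℕ → M) {n p : ℕ} (hp : p ≤ n) :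
    ∏ j ∈ range (n + 1), ∏ i ∈ range j, F i j =
      (∏ i ∈ range p, F i p) * (∏ j ∈ Ico p n, F p (j + 1)) *
        ∏ j ∈ range n, ∏ i ∈ range j, F (skip p i) (skip p j) := by
  induction n, hp using Nat.le_induction with
  | base =>
    rw [prod_range_succ, mul_comm]
    simp only [Ico_self, prod_empty, mul_one]
    congr 1
    refine prod_congr rfl fun j hj => prod_congr rfl fun i hi => ?_
    have hj := mem_range.1 hj
    have hi := mem_range.1 hi
    simp [skip, hj, hi.trans hj]
  | succ n hn ih =>
    rw [prod_range_succ, ih, prod_Ico_succ_top hn, prod_range_succ_skip hn (fun i => F i (n + 1)),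
      prod_range_succ (fun j => ∏ i ∈ range j, F (skip p i) (skip p j)) n]
    have : skip p n = n + 1 := by simp [skip]; omega
    rw [this]
    ac_rfl

/-- At `x_p = 0` the pair `(i, p)` leaves `x_i (1 + (1 - v) x_i)` and the pair `(p, j)` leaves `-x_j
(1 + u x_j)`; the latter occurs `n - p` times. Together they resupply the factor `∏ x_i` for the
smaller size. -/
theorem killVar_pairProd {n p : ℕ} (hp : p ≤ n) (u v : R) :
    killVar R p (pairProd (n + 1) u v) =
      (-1) ^ (n - p) * ((∏ i ∈ range n, Polynomial.aeval (MvPolynomial.X i)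
        (if i < p then 1 + Polynomial.C (1 - v) * Polynomial.X else
          1 + Polynomial.C u * Polynomial.X : Polynomial R)) *
        ((∏ i ∈ range n, MvPolynomial.X i) * pairProd n u v)) := by
  have hmap : ∀ x y : MvPolynomial ℕ R, killVar R p
      (pairFactor (MvPolynomial.C u) (MvPolynomial.C v) x y) =
      pairFactor (MvPolynomial.C u) (MvPolynomial.C v) (killVar R p x) (killVar R p y) := by
    intro x y
    have hC : ∀ r : R, killVar R p (MvPolynomial.C r) = MvPolynomial.C r :=
      fun r => AlgHom.commutes (killVar R p) r
    simp [pairFactor, hC]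
  have hlt : ∀ i, i < p → killVar R p (MvPolynomial.X i) = MvPolynomial.X i := by
    intro i hi; simpa [skip, hi] using killVar_X_skip (R := R) p i
  have hge : ∀ i, p ≤ i → killVar R p (MvPolynomial.X (i + 1)) = MvPolynomial.X i := by
    intro i hi; simpa [skip, Nat.not_lt.2 hi] using killVar_X_skip (R := R) p i
  have e1 : killVar R p (∏ i ∈ range p, pairFactor (MvPolynomial.C u) (MvPolynomial.C v)
      (MvPolynomial.X i) (MvPolynomial.X p)) =
      ∏ i ∈ range p, (Polynomial.aeval (MvPolynomial.X i)
        (if i < p then 1 + Polynomial.C (1 - v) * Polynomial.X else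
          1 + Polynomial.C u * Polynomial.X : Polynomial R) * MvPolynomial.X i) := by
    rw [map_prod]
    refine prod_congr rfl fun i hi => ?_
    have hi := mem_range.1 hi
    rw [hmap, hlt i hi, killVar_X_self, if_pos hi]
    simp [pairFactor, MvPolynomial.algebraMap_eq]
    ring
  have e2 : killVar R p (∏ j ∈ Ico p n, pairFactor (MvPolynomial.C u) (MvPolynomial.C v)
      (MvPolynomial.X p) (MvPolynomial.X (j + 1))) =
      (-1) ^ (n - p) * ∏ i ∈ Ico p n, (Polynomial.aeval (MvPolynomial.X i)
        (if i < p then 1 + Polynomial.C (1 - v) * Polynomial.X else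
          1 + Polynomial.C u * Polynomial.X : Polynomial R) * MvPolynomial.X i) := by
    rw [map_prod, ← Nat.card_Ico, ← prod_const, ← prod_mul_distrib]
    refine prod_congr rfl fun i hi => ?_
    have hi := (mem_Ico.1 hi).1
    rw [hmap, hge i hi, killVar_X_self, if_neg (Nat.not_lt.2 hi)]
    simp [pairFactor, MvPolynomial.algebraMap_eq]
    ring
  rw [pairProd, prod_pairs_skip _ hp, map_mul, map_mul, e1, e2, map_prod]
  simp_rw [map_prod, hmap, killVar_X_skip]
  rw [← pairProd, ← mul_assoc (∏ i ∈ range n, _), ← prod_mul_distrib, mul_left_comm,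
    prod_range_mul_prod_Ico _ hp, mul_assoc]

theorem neg_one_pow_mul_pow_sub {n p : ℕ} (hp : p ≤ n) : (-1 : R) ^ n * (-1) ^ (n - p) = (-1) ^ p := by
  rw [← pow_add, show n + (n - p) = 2 * (n - p) + p by omega, pow_add, pow_mul]
  simp

/-- Expansion of the functional over the variable that is set to zero. -/
theorem boxCoeff_pairProd_succ (n : ℕ) (u v : R) (g : ℕ → PowerSeries R) :
    boxCoeff (n + 1) (n + 1) g ((∏ i ∈ range (n + 1), MvPolynomial.X i) * pairProd (n + 1) u v) =
      ∑ p ∈ range (n + 1), (-1) ^ p * (PowerSeries.constantCoeff (g p) *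
        boxCoeff n (n + 1) (fun i => (if i < p then 1 + PowerSeries.C (1 - v) * PowerSeries.X else
          1 + PowerSeries.C u * PowerSeries.X) * g (skip p i))
          ((∏ i ∈ range n, MvPolynomial.X i) * pairProd n u v)) := by
  have hK : pairProd (n + 1) u v = vandermondeProd R (n + 1) *
      ∏ j ∈ range (n + 1), ∏ i ∈ range j, (1 + (1 - MvPolynomial.C v) * MvPolynomial.X i +
        MvPolynomial.C u * (MvPolynomial.X j + MvPolynomial.X i * MvPolynomial.X j)) := by
    simp_rw [pairProd, vandermondeProd, ← prod_mul_distrib, pairFactor]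
  conv_lhs => rw [hK]
  rw [boxCoeff_prod_X_mul_vandermondeProd, ← hK, mul_sum]
  refine sum_congr rfl fun p hp => ?_
  have hp : p ≤ n := Nat.lt_succ_iff.1 (mem_range.1 hp)
  have hneg : ∀ q : MvPolynomial ℕ R, (-1 : MvPolynomial ℕ R) ^ (n - p) * q =
      ((-1 : R) ^ (n - p)) • q := by
    intro q
    rw [MvPolynomial.smul_eq_C_mul]; simp
  -- The signs `(-1) ^ n` of the cyclic shift and `(-1) ^ (n - p)` of the pairs `(p, j)` combine to
  -- `(-1) ^ p`.
  rw [boxCoeff_X_pow_mul g hp, killVar_pairProd hp, hneg, map_smul, smul_eq_mul,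
    boxCoeff_prod_aeval_mul, mul_left_comm (PowerSeries.constantCoeff (g p)), ← mul_assoc,
    neg_one_pow_mul_pow_sub hp]
  congr 4
  funext i
  split_ifs <;> simp

/-! ### Cancellation between neighbouring variables. -/

theorem rename_swap_pairFactor (σ : Equiv.Perm ℕ) (u v : R) (x y : MvPolynomial ℕ R) :
    MvPolynomial.rename σ (pairFactor (MvPolynomial.C u) (MvPolynomial.C v) x y) =
      pairFactor (MvPolynomial.C u) (MvPolynomial.C v) (MvPolynomial.rename σ x)
        (MvPolynomial.rename σ y) := by
  simp [pairFactor]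

theorem prod_range_swap {M : Type*} [CommMonoid M] (F : ℕ → M) {n j : ℕ} (hj : j + 1 < n) :
    ∏ i ∈ range n, F (Equiv.swap j (j + 1) i) = ∏ i ∈ range n, F i := by
  refine Equiv.Perm.prod_comp (Equiv.swap j (j + 1)) _ F ?_
  intro l hl
  simp only [Finset.coe_range, Set.mem_Iio]
  by_contra hln
  exact hl (Equiv.swap_apply_of_ne_of_ne (by omega) (by omega))

/-- Up to a factor symmetric in `x_j` and `x_{j+1}`, the product over pairs is the factor of the
pair `(j, j + 1)`. -/
theorem pairProd_eq_mul_symm (u v : R) {n j : ℕ} (hj : j + 2 ≤ n) :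
    ∃ q : MvPolynomial ℕ R, MvPolynomial.rename (Equiv.swap j (j + 1)) q = q ∧
      pairProd n u v = pairFactor (MvPolynomial.C u) (MvPolynomial.C v) (MvPolynomial.X j)
        (MvPolynomial.X (j + 1)) * q := by
  have hfix : ∀ i, i < j → Equiv.swap j (j + 1) i = i := fun i hi =>
    Equiv.swap_apply_of_ne_of_ne (by omega) (by omega)
  obtain ⟨F, hF⟩ : ∃ F : ℕ → ℕ → MvPolynomial ℕ R, ∀ i l, F i l =
      pairFactor (MvPolynomial.C u) (MvPolynomial.C v) (MvPolynomial.X i) (MvPolynomial.X l) :=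
    ⟨_, fun _ _ => rfl⟩
  have hren : ∀ i l, MvPolynomial.rename (Equiv.swap j (j + 1)) (F i l) =
      F (Equiv.swap j (j + 1) i) (Equiv.swap j (j + 1) l) := by
    intro i l
    rw [hF, hF, rename_swap_pairFactor, MvPolynomial.rename_X, MvPolynomial.rename_X]
  simp_rw [pairProd, ← hF]
  clear hF
  induction n, hj using Nat.le_induction with
  | base =>
    refine ⟨(∏ l ∈ range j, ∏ i ∈ range l, F i l) * ∏ i ∈ range j, (F i j * F i (j + 1)), ?_, ?_⟩
    · have h1 : ∏ l ∈ range j, ∏ i ∈ range l,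
          F (Equiv.swap j (j + 1) i) (Equiv.swap j (j + 1) l) =
          ∏ l ∈ range j, ∏ i ∈ range l, F i l := by
        refine prod_congr rfl fun l hl => prod_congr rfl fun i hi => ?_
        have hl := mem_range.1 hl
        have hi := mem_range.1 hi
        rw [hfix l hl, hfix i (hi.trans hl)]
      have h2 : ∏ i ∈ range j, (F (Equiv.swap j (j + 1) i) (j + 1) *
          F (Equiv.swap j (j + 1) i) j) = ∏ i ∈ range j, (F i j * F i (j + 1)) := by
        refine prod_congr rfl fun i hi => ?_
        rw [hfix i (mem_range.1 hi), mul_comm]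
      simp only [map_mul, map_prod, hren, Equiv.swap_apply_left, Equiv.swap_apply_right]
      rw [h1, h2]
    · rw [prod_range_succ, prod_range_succ, prod_range_succ _ j, prod_mul_distrib]
      ring
  | succ n hn ih =>
    obtain ⟨q, hq, h⟩ := ih
    -- The new index `n` is fixed by the swap, which only permutes the factors `F i n` with `i < n`.
    refine ⟨q * ∏ i ∈ range n, F i n, ?_, ?_⟩
    · simp only [map_mul, map_prod, hq, hren]
      rw [Equiv.swap_apply_of_ne_of_ne (a := j) (b := j + 1) (x := n) (by omega) (by omega),
        prod_range_swap (fun i => F i n) hn]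
    · rw [prod_range_succ, h, mul_assoc]

/-- A pair of neighbouring variables that interact through `(1 + u x_j) (1 + (1 - v) x_{j+1})`,
corrected by `u v x_j x_{j+1}`, does not contribute. -/
theorem boxCoeff_adjacent_eq_zero (u v : R) {n N j : ℕ} (g : ℕ → PowerSeries R) (hj : j + 2 ≤ n)
    (hg : g j = g (j + 1)) {s : MvPolynomial ℕ R}
    (hs : MvPolynomial.rename (Equiv.swap j (j + 1)) s = s) :
    boxCoeff n N g (s *
      ((1 + MvPolynomial.C u * MvPolynomial.X j) *
        (1 + (1 - MvPolynomial.C v) * MvPolynomial.X (j + 1)) +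
        MvPolynomial.C (u * v) * (MvPolynomial.X j * MvPolynomial.X (j + 1))) *
      ((∏ i ∈ range n, MvPolynomial.X i) * pairProd n u v)) = 0 := by
  obtain ⟨q, hq, h⟩ := pairProd_eq_mul_symm u v hj
  rw [h]
  set x : MvPolynomial ℕ R := MvPolynomial.X j with hx
  set y : MvPolynomial ℕ R := MvPolynomial.X (j + 1) with hy
  set U : MvPolynomial ℕ R := MvPolynomial.C u with hU
  set V : MvPolynomial ℕ R := MvPolynomial.C v with hV
  -- Since `u (1 - v) + u v = u`, the corrected interaction is `1 + u x + (1 - v) y + u x y`. This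
  -- is the second factor of `pairFactor` with `x` and `y` exchanged, so the product of the two is
  -- symmetric.
  have e : s * ((1 + U * x) * (1 + (1 - V) * y) + MvPolynomial.C (u * v) * (x * y)) *
      ((∏ i ∈ range n, MvPolynomial.X i) * (pairFactor U V x y * q)) =
      (x - y) * (s * ((1 + U * x + (1 - V) * y + U * x * y) *
        (1 + U * y + (1 - V) * x + U * x * y)) * (∏ i ∈ range n, MvPolynomial.X i) * q) := by
    rw [MvPolynomial.C_mul, ← hU, ← hV, pairFactor]
    ring
  rw [e]
  refine boxCoeff_X_sub_X_mul g (by omega) (by omega) hg ?_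
  have hxy : MvPolynomial.rename (Equiv.swap j (j + 1)) x = y := by simp [hx, hy]
  have hyx : MvPolynomial.rename (Equiv.swap j (j + 1)) y = x := by simp [hx, hy]
  have hprod : MvPolynomial.rename (Equiv.swap j (j + 1))
      (∏ i ∈ range n, MvPolynomial.X i : MvPolynomial ℕ R) = ∏ i ∈ range n, MvPolynomial.X i := by
    simp only [map_prod, MvPolynomial.rename_X]
    exact prod_range_swap (fun i => (MvPolynomial.X i : MvPolynomial ℕ R)) (by omega)
  have hUU : MvPolynomial.rename (Equiv.swap j (j + 1)) U = U := by simp [hU]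
  have hVV : MvPolynomial.rename (Equiv.swap j (j + 1)) V = V := by simp [hV]
  simp only [map_mul, map_add, map_sub, map_one, hs, hq, hprod, hxy, hyx, hUU, hVV]
  ring

/-! ### Reduction of the three-term recursion to an alternating sum. -/

/-- `∑_p (-1) ^ p l_0 ⋯ l_{p-1} r_p ⋯ r_{j-1}`. -/
def cutSum {A : Type*} [CommRing A] (l r : ℕ → A) (j : ℕ) : A :=
  ∑ p ∈ range (j + 1), (-1) ^ p * ((∏ i ∈ range p, l i) * ∏ i ∈ Ico p j, r i)

theorem cutSum_succ {A : Type*} [CommRing A] (l r : ℕ → A) (j : ℕ) :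
    cutSum l r (j + 1) = cutSum l r j * r j + (-1) ^ (j + 1) * ∏ i ∈ range (j + 1), l i := by
  rw [cutSum, sum_range_succ, cutSum, sum_mul]
  congr 1
  · refine sum_congr rfl fun p hp => ?_
    rw [prod_Ico_succ_top (Nat.lt_succ_iff.1 (mem_range.1 hp))]
    ring
  · simp

/-- A sequence of polynomials that satisfies the three-term recursion of strictly increasing
interlacing sequences is equivalent to `cutSum` under a functional that annihilates the
interaction of neighbours. -/
theorem apply_eq_apply_cutSum {A : Type*} [CommRing A] [Algebra R A] (V : A →ₗ[R] R)
    (S : ℕ → Subalgebra R A) (hS : ∀ j, S (j + 1) ≤ S j) (l r e Z : ℕ → A) (k : ℕ)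
    (hl : ∀ j, l j ∈ S j) (hr : ∀ j, r j ∈ S j) (he : ∀ j, e j ∈ S j)
    (hZ0 : Z 0 = 1) (hZ1 : 1 ≤ k → Z 1 = r 0 - l 0)
    (hZ : ∀ j, j + 2 ≤ k → Z (j + 2) = Z (j + 1) * (r (j + 1) - l (j + 1)) - e j * Z j)
    (hV : ∀ j, j + 2 ≤ k → ∀ s ∈ S (j + 2),
      V (cutSum l r j * (r j * l (j + 1) + e j) * s) = 0) :
    ∀ j ≤ k, ∀ s ∈ S j, V (Z j * s) = V (cutSum l r j * s) := by
  intro j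
  induction j using Nat.strong_induction_on with
  | _ j ih =>
    intro hjk s hs
    -- The extra factor `s`, which involves only later variables, lets the induction hypotheses
    -- absorb `r (j + 1) - l (j + 1)` and `e j`.
    match j, ih, hjk, hs with
    | 0, _, _, _ => simp [hZ0, cutSum]
    | 1, _, hjk, _ =>
      have : cutSum l r 1 = r 0 - l 0 := by simp [cutSum, sum_range_succ]; ring
      rw [hZ1 hjk, this]
    | j + 2, ih, hjk, hs =>
      have hs1 : s ∈ S (j + 1) := hS _ hs
      have h1 := ih (j + 1) (by omega) (by omega) ((r (j + 1) - l (j + 1)) * s)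
        (mul_mem (sub_mem (hr _) (hl _)) hs1)
      have h2 := ih j (by omega) (by omega) (e j * s) (mul_mem (he j) (hS _ hs1))
      have e1 : Z (j + 2) * s = Z (j + 1) * ((r (j + 1) - l (j + 1)) * s) - Z j * (e j * s) := by
        rw [hZ j hjk]; ring
      -- Appending `l (j + 1)` to a word that ends in `r j` creates the forbidden pattern; together
      -- with `e j` this is all that separates the recursion from `cutSum l r (j + 2)`.
      have e2 : cutSum l r (j + 1) * ((r (j + 1) - l (j + 1)) * s) - cutSum l r j * (e j * s) =
          cutSum l r (j + 2) * s - cutSum l r j * (r j * l (j + 1) + e j) * s := by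
        rw [cutSum_succ l r (j + 1), prod_range_succ _ (j + 1), cutSum_succ l r j]
        ring
      rw [e1, map_sub, h1, h2, ← map_sub, e2, map_sub, hV j hjk s hs, sub_zero]

/-! ### Weighted sums over rows interlacing with a given row. -/

/-- The weight of the entry `c` at the `i`-th place of a row, of which the `i`-th and the
`(i+1)`-st entry below are `β i` and `β (i+1)`. -/
def entryWeight (β : ℕ → ℕ) (us : ℕ → R) (v : R) (i c : ℕ) : R :=
  if c = β i then v else if c = β (i + 1) then us i else if β i < c ∧ c < β (i + 1) then 1 else 0

theorem bounds_of_entryWeight_ne_zero {β : ℕ → ℕ} {us : ℕ → R} {v : R} {i c : ℕ}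
    (hβ : β i < β (i + 1)) (h : entryWeight β us v i c ≠ 0) : β i ≤ c ∧ c ≤ β (i + 1) := by
  unfold entryWeight at h
  split_ifs at h <;> first | omega | exact absurd rfl h

/-- As `x (1 + x) ^ c = (1 + x) ^ (c + 1) - (1 + x) ^ c`, the interior values telescope to `(1 + x)
^ β (i + 1) - (1 + x) ^ (β i + 1)`; the two end values then modify the two terms by `us i` and `v`.
-/
theorem sum_entryWeight_mul {A : Type*} [CommRing A] [Algebra R A] (β : ℕ → ℕ) (us : ℕ → R)
    (v : R) {i B : ℕ} (hβ : β i < β (i + 1)) (hB : β (i + 1) < B) (x : A) :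
    ∑ c ∈ range B, algebraMap R A (entryWeight β us v i c) * (x * (1 + x) ^ c) =
      (1 + algebraMap R A (us i) * x) * (1 + x) ^ β (i + 1) -
        (1 + (1 - algebraMap R A v) * x) * (1 + x) ^ β i := by
  have h1 : ∀ c, algebraMap R A (entryWeight β us v i c) * (x * (1 + x) ^ c) =
      (if c = β i then algebraMap R A v * (x * (1 + x) ^ c) else 0) +
      (if c = β (i + 1) then algebraMap R A (us i) * (x * (1 + x) ^ c) else 0) +
      (if c ∈ Ico (β i + 1) (β (i + 1)) then x * (1 + x) ^ c else 0) := by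
    intro c
    unfold entryWeight
    simp only [mem_Ico]
    split_ifs <;> first | omega | simp
  have h2 : ∀ b, β i + 1 ≤ b → ∑ c ∈ Ico (β i + 1) b, x * (1 + x) ^ c =
      (1 + x) ^ b - (1 + x) ^ (β i + 1) := by
    intro b hb
    induction b, hb using Nat.le_induction with
    | base => simp
    | succ b hb ih => rw [sum_Ico_succ_top hb, ih]; ring
  simp_rw [h1, sum_add_distrib]
  rw [sum_ite_eq', sum_ite_eq', if_pos (mem_range.2 (by omega)), if_pos (mem_range.2 hB),
    sum_ite_mem, inter_eq_right.2, h2 _ hβ]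
  · ring
  · intro c hc
    have := mem_Ico.1 hc
    exact mem_range.2 (by omega)

/-- The weight of a row: the product of the weights of the entries if these are strictly
increasing, and `0` otherwise. -/
noncomputable def rowWeight (w : ℕ → ℕ → R) {j : ℕ} (a : Fin j → ℕ) : R :=
  open Classical in (∏ i : Fin j, w i (a i)) * if StrictMono a then 1 else 0

theorem strictMono_snoc {j : ℕ} {a : Fin j → ℕ} {c : ℕ} :
    StrictMono (Fin.snoc a c : Fin (j + 1) → ℕ) ↔ StrictMono a ∧ ∀ i, a i < c := by
  constructor
  · intro h
    refine ⟨fun i i' hi => ?_, fun i => ?_⟩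
    · simpa using h (Fin.castSucc_lt_castSucc_iff.2 hi)
    · simpa using h (Fin.castSucc_lt_last i)
  · rintro ⟨h1, h2⟩ i i' hi
    induction i' using Fin.lastCases with
    | last =>
      induction i using Fin.lastCases with
      | last => exact absurd hi (lt_irrefl _)
      | cast i => simpa using h2 i
    | cast i' =>
      induction i using Fin.lastCases with
      | last => exact absurd hi (Fin.castSucc_lt_last i').asymm
      | cast i => simpa using h1 (Fin.castSucc_lt_castSucc_iff.1 hi)

open Classical in
theorem rowWeight_snoc (w : ℕ → ℕ → R) {j : ℕ} (a : Fin j → ℕ) (c : ℕ) :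
    rowWeight w (Fin.snoc a c : Fin (j + 1) → ℕ) =
      rowWeight w a * (w j c * if ∀ i, a i < c then 1 else 0) := by
  rw [rowWeight, rowWeight, Fin.prod_univ_castSucc]
  simp only [strictMono_snoc, Fin.snoc_castSucc, Fin.snoc_last, Fin.val_castSucc, Fin.val_last]
  split_ifs <;> simp_all

theorem sum_piFinset_snoc {A : Type*} [AddCommMonoid A] (B j : ℕ) (F : (Fin (j + 1) → ℕ) → A) :
    ∑ a ∈ Fintype.piFinset fun _ : Fin (j + 1) => range B, F a =
      ∑ a ∈ Fintype.piFinset fun _ : Fin j => range B, ∑ c ∈ range B, F (Fin.snoc a c) := by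
  rw [← sum_product']
  refine sum_nbij' (fun a => (fun i => a i.castSucc, a (Fin.last j)))
    (fun p => Fin.snoc p.1 p.2) ?_ ?_ ?_ ?_ ?_
  · intro a ha
    simp only [Fintype.mem_piFinset, mem_product] at ha ⊢
    exact ⟨fun i => ha _, ha _⟩
  · rintro ⟨a, c⟩ h
    simp only [Fintype.mem_piFinset, mem_product] at h ⊢
    intro i
    induction i using Fin.lastCases with
    | last => simpa using h.2
    | cast i => simpa using h.1 i
  · intro a _
    exact Fin.snoc_init_self a
  · rintro ⟨a, c⟩ _
    simp
  · intro a _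
    congr 1
    exact (Fin.snoc_init_self a).symm

/-- The sum of `∏ x_i (1 + x_i) ^ a_i` over all sequences `a` of length `j`, weighted as rows. -/
noncomputable def rowSum (A : Type*) [CommRing A] [Algebra R A] (w : ℕ → ℕ → R) (x : ℕ → A)
    (B j : ℕ) : A :=
  ∑ a ∈ Fintype.piFinset fun _ : Fin j => range B,
    algebraMap R A (rowWeight w a) * ∏ i : Fin j, (x i * (1 + x i) ^ a i)

theorem rowSum_zero (A : Type*) [CommRing A] [Algebra R A] (w : ℕ → ℕ → R) (x : ℕ → A) (B : ℕ) :
    rowSum A w x B 0 = 1 := by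
  simp [rowSum, rowWeight, Subsingleton.strictMono]

theorem rowSum_one (A : Type*) [CommRing A] [Algebra R A] (w : ℕ → ℕ → R) (x : ℕ → A) (B : ℕ) :
    rowSum A w x B 1 = ∑ c ∈ range B, algebraMap R A (w 0 c) * (x 0 * (1 + x 0) ^ c) := by
  rw [rowSum, sum_piFinset_snoc]
  simp [rowWeight, Subsingleton.strictMono, Fin.snoc]

theorem bounds_of_rowWeight_ne_zero {β : ℕ → ℕ} {us : ℕ → R} {v : R} {j : ℕ}
    (hβ : ∀ i < j, β i < β (i + 1)) {a : Fin j → ℕ} (h : rowWeight (entryWeight β us v) a ≠ 0) :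
    StrictMono a ∧ ∀ i : Fin j, β i ≤ a i ∧ a i ≤ β (i + 1) := by
  unfold rowWeight at h
  refine ⟨?_, fun i => bounds_of_entryWeight_ne_zero (us := us) (v := v) (hβ i i.2) fun h0 => h ?_⟩
  · by_contra hm
    simp [hm] at h
  · rw [prod_eq_zero (mem_univ i) h0, zero_mul]

/-- Nonzero weights force `c ≤ β (j + 1) ≤ d`, so `c < d` fails only for `c = d = β (j + 1)`. The
subtracted term removes this one collision, of weight `us j * v`. -/
theorem rowWeight_snoc_snoc {β : ℕ → ℕ} {us : ℕ → R} {v : R} {j : ℕ}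
    (hβ : ∀ i < j + 2, β i < β (i + 1)) (a : Fin j → ℕ) (c d : ℕ) :
    rowWeight (entryWeight β us v) (Fin.snoc (Fin.snoc a c : Fin (j + 1) → ℕ) d : Fin (j + 2) → ℕ) =
      rowWeight (entryWeight β us v) (Fin.snoc a c : Fin (j + 1) → ℕ) *
          entryWeight β us v (j + 1) d -
        rowWeight (entryWeight β us v) a *
          ((if c = β (j + 1) then 1 else 0) * (if d = β (j + 1) then us j * v else 0)) := by
  classical
  set w := entryWeight β us v with hw
  rw [rowWeight_snoc w _ d, rowWeight_snoc w a c]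
  by_cases h0 : rowWeight w a = 0
  · simp [h0]
  obtain ⟨-, hb⟩ := bounds_of_rowWeight_ne_zero (fun i hi => hβ i (by omega)) h0
  have hmono : ∀ i l, i ≤ l → l ≤ j + 2 → β i ≤ β l := by
    intro i l hil
    induction l, hil using Nat.le_induction with
    | base => intro _; rfl
    | succ l _ ih => intro hl; exact (ih (by omega)).trans (hβ l (by omega)).le
  -- Earlier entries stay below `β (j + 1)`, so in the colliding case the order conditions involving
  -- them hold by themselves.
  have ha : ∀ i, a i ≤ β j := fun i => (hb i).2.trans (hmono _ _ i.2 (by omega))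
  have hj := hβ j (by omega)
  have hj1 := hβ (j + 1) (by omega)
  have hall : (∀ i, (Fin.snoc a c : Fin (j + 1) → ℕ) i < d) ↔ (∀ i, a i < d) ∧ c < d := by
    rw [Fin.forall_fin_succ']
    simp
  simp only [hall]
  by_cases hcd : c = β (j + 1) ∧ d = β (j + 1)
  · obtain ⟨rfl, rfl⟩ := hcd
    have e1 : w j (β (j + 1)) = us j := by simp [hw, entryWeight, hj.ne']
    have e2 : w (j + 1) (β (j + 1)) = v := by simp [hw, entryWeight]
    have e3 : ∀ i, a i < β (j + 1) := fun i => (ha i).trans_lt hj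
    simp [e1, e2, e3]
    ring
  · have e : (if c = β (j + 1) then (1 : R) else 0) * (if d = β (j + 1) then us j * v else 0) = 0 := by
      split_ifs <;> simp_all
    rw [e]
    by_cases hlt : c < d
    · by_cases hac : ∀ i, a i < c
      · have : ∀ i, a i < d := fun i => (hac i).trans hlt
        simp [hac, this, hlt]
      · simp [hac]
    · have hz : w j c * w (j + 1) d = 0 := by
        by_contra hne
        have h1 := (bounds_of_entryWeight_ne_zero hj (left_ne_zero_of_mul hne)).2
        have h2 := (bounds_of_entryWeight_ne_zero hj1 (right_ne_zero_of_mul hne)).1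
        omega
      have hr : rowWeight w a * (w j c * if ∀ i, a i < c then 1 else 0) * w (j + 1) d =
          rowWeight w a * (if ∀ i, a i < c then 1 else 0) * (w j c * w (j + 1) d) := by ring
      simp only [hlt, and_false, if_false, mul_zero]
      rw [hr, hz]
      simp

theorem rowSum_succ_succ (A : Type*) [CommRing A] [Algebra R A] {β : ℕ → ℕ} {us : ℕ → R} {v : R}
    {j B : ℕ} (hβ : ∀ i < j + 2, β i < β (i + 1)) (hB : β (j + 2) < B) (x : ℕ → A) :
    rowSum A (entryWeight β us v) x B (j + 2) =
      rowSum A (entryWeight β us v) x B (j + 1) *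
        ((1 + algebraMap R A (us (j + 1)) * x (j + 1)) * (1 + x (j + 1)) ^ β (j + 2) -
          (1 + (1 - algebraMap R A v) * x (j + 1)) * (1 + x (j + 1)) ^ β (j + 1)) -
      algebraMap R A (us j * v) * (x j * (1 + x j) ^ β (j + 1) *
        (x (j + 1) * (1 + x (j + 1)) ^ β (j + 1))) * rowSum A (entryWeight β us v) x B j := by
  have hj := hβ j (by omega)
  have hj1 : β (j + 1) < β (j + 2) := hβ (j + 1) (by omega)
  rw [← sum_entryWeight_mul β us v hj1 hB, rowSum, rowSum, rowSum, sum_piFinset_snoc,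
    sum_piFinset_snoc, sum_piFinset_snoc, sum_mul, mul_sum, ← sum_sub_distrib]
  refine sum_congr rfl fun a _ => ?_
  -- The collision term is written as a double sum with one nonzero summand, so that the identity
  -- can be compared for each `c` and `d`.
  have hsingle : algebraMap R A (us j * v) * (x j * (1 + x j) ^ β (j + 1) *
        (x (j + 1) * (1 + x (j + 1)) ^ β (j + 1))) *
        (algebraMap R A (rowWeight (entryWeight β us v) a) *
          ∏ i : Fin j, (x i * (1 + x i) ^ a i)) =
      ∑ c ∈ range B, ∑ d ∈ range B, algebraMap R A (rowWeight (entryWeight β us v) a *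
          ((if c = β (j + 1) then 1 else 0) * (if d = β (j + 1) then us j * v else 0))) *
        ((∏ i : Fin j, (x i * (1 + x i) ^ a i)) * (x j * (1 + x j) ^ c) *
          (x (j + 1) * (1 + x (j + 1)) ^ d)) := by
    rw [sum_eq_single (β (j + 1)), sum_eq_single (β (j + 1))]
    · simp
      ring
    · intro d _ hd; simp [hd]
    · intro h; exact absurd (mem_range.2 (by omega)) h
    · intro c _ hc; simp [hc]
    · intro h; exact absurd (mem_range.2 (by omega)) h
  rw [hsingle, sum_mul, ← sum_sub_distrib]
  refine sum_congr rfl fun c _ => ?_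
  rw [mul_sum, ← sum_sub_distrib]
  refine sum_congr rfl fun d _ => ?_
  rw [rowWeight_snoc_snoc hβ]
  simp only [Fin.prod_univ_castSucc, Fin.snoc_castSucc, Fin.snoc_last, Fin.val_castSucc, Fin.val_last, map_sub, map_mul]
  ring

/-! ### The recursion of the constant terms. -/

theorem rename_swap_of_mem_supported {j : ℕ} {s : MvPolynomial ℕ R}
    (hs : s ∈ MvPolynomial.supported R (Set.Ici (j + 2))) :
    MvPolynomial.rename (Equiv.swap j (j + 1)) s = s := by
  have h : MvPolynomial.supported R (Set.Ici (j + 2)) ≤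
      AlgHom.equalizer (MvPolynomial.rename (R := R) (Equiv.swap j (j + 1))) (AlgHom.id R _) := by
    refine Algebra.adjoin_le ?_
    rintro _ ⟨i, hi, rfl⟩
    have hi : j + 2 ≤ i := hi
    have : Equiv.swap j (j + 1) i = i := Equiv.swap_apply_of_ne_of_ne (by omega) (by omega)
    simp [this]
  exact h hs

/-- `apply_eq_apply_cutSum` is applied with `S j` the polynomials in the variables of index at least
`j`. The interaction of `j` and `j + 1` involves `us j` only for `j + 2 ≤ k`, so the last value of
`us` is free. -/
theorem boxCoeff_rowSum_eq_cutSum (u v : R) {n N k : ℕ} (hk : k ≤ n) (g : ℕ → PowerSeries R)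
    (hg : ∀ i < k, g i = 1) (β : ℕ → ℕ) (hβ : ∀ i < k, β i < β (i + 1)) (us : ℕ → R)
    (hus : ∀ i, i + 1 < k → us i = u) {B : ℕ} (hB : ∀ i < k, β (i + 1) < B) :
    boxCoeff n N g (rowSum (MvPolynomial ℕ R) (entryWeight β us v) MvPolynomial.X B k *
        ((∏ i ∈ range n, MvPolynomial.X i) * pairProd n u v)) =
      boxCoeff n N g (cutSum
        (fun i => (1 + (1 - MvPolynomial.C v) * MvPolynomial.X i) *
          (1 + MvPolynomial.X i) ^ β i)
        (fun i => (1 + MvPolynomial.C (us i) * MvPolynomial.X i) *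
          (1 + MvPolynomial.X i) ^ β (i + 1)) k *
        ((∏ i ∈ range n, MvPolynomial.X i) * pairProd n u v)) := by
  set M := (∏ i ∈ range n, MvPolynomial.X i) * pairProd n u v with hM
  set l : ℕ → MvPolynomial ℕ R := fun i => (1 + (1 - MvPolynomial.C v) * MvPolynomial.X i) *
          (1 + MvPolynomial.X i) ^ β i with hl
  set r : ℕ → MvPolynomial ℕ R := fun i => (1 + MvPolynomial.C (us i) * MvPolynomial.X i) *
          (1 + MvPolynomial.X i) ^ β (i + 1) with hr
  set S : ℕ → Subalgebra R (MvPolynomial ℕ R) := fun j =>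
    MvPolynomial.supported R (Set.Ici j) with hS
  have hX : ∀ i j, j ≤ i → (MvPolynomial.X i : MvPolynomial ℕ R) ∈ S j := fun i j h =>
    Algebra.subset_adjoin ⟨i, h, rfl⟩
  have hC : ∀ (c : R) j, (MvPolynomial.C c : MvPolynomial ℕ R) ∈ S j := fun c j =>
    Subalgebra.algebraMap_mem (S j) c
  have key := apply_eq_apply_cutSum (R := R) ((boxCoeff n N g) ∘ₗ LinearMap.mulRight R M) S
    (fun j => MvPolynomial.supported_mono (Set.Ici_subset_Ici.2 (Nat.le_succ j))) l r
    (fun j => MvPolynomial.C (us j * v) * (MvPolynomial.X j * (1 + MvPolynomial.X j) ^ β (j + 1) *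
      (MvPolynomial.X (j + 1) * (1 + MvPolynomial.X (j + 1)) ^ β (j + 1))))
    (rowSum (MvPolynomial ℕ R) (entryWeight β us v) MvPolynomial.X B) k
    (fun j => mul_mem (add_mem (one_mem _) (mul_mem (sub_mem (one_mem _) (hC _ _))
      (hX _ _ le_rfl))) (pow_mem (add_mem (one_mem _) (hX _ _ le_rfl)) _))
    (fun j => mul_mem (add_mem (one_mem _) (mul_mem (hC _ _) (hX _ _ le_rfl)))
      (pow_mem (add_mem (one_mem _) (hX _ _ le_rfl)) _))
    (fun j => mul_mem (hC _ _) (mul_mem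
      (mul_mem (hX _ _ le_rfl) (pow_mem (add_mem (one_mem _) (hX _ _ le_rfl)) _))
      (mul_mem (hX _ _ (Nat.le_succ j)) (pow_mem (add_mem (one_mem _) (hX _ _ (Nat.le_succ j))) _))))
    (rowSum_zero _ _ _ _)
    (fun h => by
      rw [rowSum_one, sum_entryWeight_mul β us v (hβ 0 h) (hB 0 h)]
      simp only [MvPolynomial.algebraMap_eq]; rfl)
    (fun j hj => by
      rw [rowSum_succ_succ _ (fun i hi => hβ i (by omega)) (hB (j + 1) (by omega))]
      simp only [MvPolynomial.algebraMap_eq]; rfl)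
    (fun j hj s hs => by
      have e : cutSum l r j * (r j * l (j + 1) + MvPolynomial.C (us j * v) *
          (MvPolynomial.X j * (1 + MvPolynomial.X j) ^ β (j + 1) *
          (MvPolynomial.X (j + 1) * (1 + MvPolynomial.X (j + 1)) ^ β (j + 1)))) * s =
          (cutSum l r j * s * ((1 + MvPolynomial.X j) ^ β (j + 1) *
            (1 + MvPolynomial.X (j + 1)) ^ β (j + 1))) *
          ((1 + MvPolynomial.C u * MvPolynomial.X j) *
            (1 + (1 - MvPolynomial.C v) * MvPolynomial.X (j + 1)) +
            MvPolynomial.C (u * v) * (MvPolynomial.X j * MvPolynomial.X (j + 1))) := by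
        simp only [hl, hr, hus j (by omega)]
        ring
      rw [e, LinearMap.comp_apply, LinearMap.mulRight_apply]
      refine boxCoeff_adjacent_eq_zero u v g (by omega)
        (by rw [hg j (by omega), hg (j + 1) (by omega)]) ?_
      -- `cutSum l r j` involves only variables of index below `j`.
      have hcut : MvPolynomial.rename (Equiv.swap j (j + 1)) (cutSum l r j) = cutSum l r j := by
        have hfix : ∀ i < j, Equiv.swap j (j + 1) i = i := fun i hi =>
          Equiv.swap_apply_of_ne_of_ne (by omega) (by omega)
        have hl' : ∀ i < j, MvPolynomial.rename (Equiv.swap j (j + 1)) (l i) = l i := by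
          intro i hi; simp [hl, hfix i hi]
        have hr' : ∀ i < j, MvPolynomial.rename (Equiv.swap j (j + 1)) (r i) = r i := by
          intro i hi; simp [hr, hfix i hi]
        rw [cutSum, map_sum]
        refine sum_congr rfl fun p hp => ?_
        have hp := mem_range.1 hp
        rw [map_mul, map_mul, map_prod, map_prod, map_pow, map_neg, map_one]
        congr 2
        · exact prod_congr rfl fun i hi => hl' i (by have := mem_range.1 hi; omega)
        · exact prod_congr rfl fun i hi => hr' i (mem_Ico.1 hi).2
      simp only [map_mul, map_pow, map_add, map_one, hcut, rename_swap_of_mem_supported hs,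
        MvPolynomial.rename_X, Equiv.swap_apply_left, Equiv.swap_apply_right]
      ring)
    k le_rfl 1 (one_mem _)
  simpa using key

/-- A row as a function on all places, which are numbered from `1`. -/
def rowFun {j : ℕ} (a : Fin j → ℕ) (i : ℕ) : ℕ :=
  if h : 1 ≤ i ∧ i ≤ j then a ⟨i - 1, by omega⟩ else 0

theorem rowFun_succ {j : ℕ} (a : Fin j → ℕ) {i : ℕ} (hi : i < j) : rowFun a (i + 1) = a ⟨i, hi⟩ := by
  rw [rowFun, dif_pos ⟨by omega, by omega⟩]
  rfl

/-- The factors of `gogLaurentSeries` in single variables, up to a common power. -/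
noncomputable def gogFactor (m k : ℕ) (b : ℕ → ℕ) (u : R) (i : ℕ) : PowerSeries R :=
  if i < k then (1 + PowerSeries.X) ^ b (i + 1) else
    (1 + PowerSeries.X) ^ (m + i + 2) *
      ((onePlusUnit u)⁻¹ : (PowerSeries R)ˣ).val ^ (i + 1 - k) * PowerSeries.X ^ (i - k)

theorem onePlus_mul_inv (u : R) :
    (1 + PowerSeries.C u * PowerSeries.X) * ((onePlusUnit u)⁻¹ : (PowerSeries R)ˣ).val = 1 :=
  (onePlusUnit u).val_inv

/-- The power `X ^ (i - k)` truncates the expansion over the eliminated variable at `p = k`, where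
`cutSum` also stops. -/
theorem constantCoeff_gogFactor (m k : ℕ) (b : ℕ → ℕ) (u : R) (i : ℕ) :
    PowerSeries.constantCoeff (gogFactor m k b u i) = if i ≤ k then 1 else 0 := by
  have hW : PowerSeries.constantCoeff ((onePlusUnit u)⁻¹ : (PowerSeries R)ˣ).val = 1 := by
    have := congrArg PowerSeries.constantCoeff (onePlus_mul_inv u)
    simpa using this
  rcases lt_trichotomy i k with h | h | h
  · simp [gogFactor, h, h.le]
  · subst h; simp [gogFactor, hW]
  · rw [if_neg (by omega), gogFactor, if_neg (by omega), map_mul, map_pow _ PowerSeries.X,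
      PowerSeries.constantCoeff_X, zero_pow (by omega), mul_zero]

/-- The bottom row of a trapezoid, followed by the bound for the entries of the row above it. -/
def bottomSeq (m k : ℕ) (b : ℕ → ℕ) (i : ℕ) : ℕ := if i < k then b (i + 1) else m + k + 2

/-- The constant terms satisfy the recursion for the removal of the bottom row. -/
theorem boxCoeff_gogFactor_succ (u v : R) {m n k : ℕ} (hk : k ≤ n + 1) (b : ℕ → ℕ)
    (hβ : ∀ i < min k n, bottomSeq m k b i < bottomSeq m k b (i + 1)) {B : ℕ}
    (hB : ∀ i < min k n, bottomSeq m k b (i + 1) < B) :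
    boxCoeff (n + 1) (n + 1) (gogFactor m k b u)
        ((∏ i ∈ range (n + 1), MvPolynomial.X i) * pairProd (n + 1) u v) =
      ∑ a ∈ Fintype.piFinset fun _ : Fin (min k n) => range B,
        rowWeight (entryWeight (bottomSeq m k b) (fun i => if i + 1 < k then u else 0) v) a *
          boxCoeff n n (gogFactor (m + 1) (min k n) (rowFun a) u)
            ((∏ i ∈ range n, MvPolynomial.X i) * pairProd n u v) := by
  set k' := min k n with hk'
  set us : ℕ → R := fun i => if i + 1 < k then u else 0 with hus
  set β := bottomSeq m k b with hβdef
  set M := (∏ i ∈ range n, MvPolynomial.X i) * pairProd n u v with hM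
  -- The factors common to all rows `a`: those of index below `k'` have been moved into the
  -- polynomial argument.
  set g : ℕ → PowerSeries R := fun i => if i < k' then 1 else
    (1 + PowerSeries.C u * PowerSeries.X) * gogFactor m k b u (i + 1) with hg
  have hprod : ∀ F : ℕ → MvPolynomial ℕ R, ∏ i ∈ range k', F i =
      ∏ i ∈ range n, if i < k' then F i else 1 := by
    intro F
    rw [← prod_subset (range_subset_range.2 (min_le_right k n : k' ≤ n))]
    · exact prod_congr rfl fun i hi => (if_pos (mem_range.1 hi)).symm
    · intro i _ hi
      exact if_neg fun h => hi (mem_range.2 h)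
  have hrow : ∀ a : Fin k' → ℕ, boxCoeff n n (gogFactor (m + 1) k' (rowFun a) u) M =
      boxCoeff n (n + 1) g
        ((∏ i : Fin k', (MvPolynomial.X (i : ℕ) * (1 + MvPolynomial.X (i : ℕ)) ^ a i)) * M) := by
    intro a
    have e : ∏ i : Fin k', (MvPolynomial.X (i : ℕ) * (1 + MvPolynomial.X (i : ℕ)) ^ a i) =
        ∏ i ∈ range n, Polynomial.aeval (MvPolynomial.X i : MvPolynomial ℕ R)
          (if i < k' then Polynomial.X * (1 + Polynomial.X) ^ rowFun a (i + 1) else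
            1 : Polynomial R) := by
      have e1 : ∏ i : Fin k', (MvPolynomial.X (i : ℕ) * (1 + MvPolynomial.X (i : ℕ)) ^ a i) =
          ∏ i ∈ range k', ((MvPolynomial.X i : MvPolynomial ℕ R) *
            (1 + MvPolynomial.X i) ^ rowFun a (i + 1)) := by
        rw [prod_range]
        exact prod_congr rfl fun i _ => by rw [rowFun_succ a i.2]
      rw [e1, hprod]
      refine prod_congr rfl fun i _ => ?_
      split_ifs <;> simp
    -- Raising the target exponent from `n` to `n + 1` accounts for the extra `x_i` in `x_i (1 +
    -- x_i) ^ a i`.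
    rw [e, boxCoeff_prod_aeval_mul, ← boxCoeff_X_mul]
    refine LinearMap.congr_fun (boxCoeff_congr fun i hi => ?_) M
    by_cases hik : i < k'
    · simp [gogFactor, hg, hik]
    · have hkk : k' = k := by omega
      simp only [hg, if_neg hik, Polynomial.coe_one, one_mul, gogFactor,
        if_neg (show ¬ i + 1 < k by omega)]
      rw [hkk, show i + 1 + 1 - k = (i + 1 - k) + 1 by omega, show i + 1 - k = (i - k) + 1 by omega,
        show m + (i + 1) + 2 = m + 1 + i + 2 by omega]
      linear_combination -((1 + PowerSeries.X) ^ (m + 1 + i + 2) *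
        ((onePlusUnit u)⁻¹ : (PowerSeries R)ˣ).val ^ (i - k + 1) * PowerSeries.X ^ (i - k + 1)) *
        onePlus_mul_inv u
  have hsum : ∑ a ∈ Fintype.piFinset fun _ : Fin k' => range B, rowWeight (entryWeight β us v) a *
      boxCoeff n n (gogFactor (m + 1) k' (rowFun a) u) M =
      boxCoeff n (n + 1) g
        (rowSum (MvPolynomial ℕ R) (entryWeight β us v) MvPolynomial.X B k' * M) := by
    rw [rowSum, sum_mul, map_sum]
    refine sum_congr rfl fun a _ => ?_
    rw [hrow, mul_assoc, ← Algebra.smul_def, map_smul, smul_eq_mul]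
  rw [hsum, boxCoeff_rowSum_eq_cutSum u v (min_le_right k n) g (fun i hi => if_pos hi) β hβ us
    (fun i hi => if_pos (by omega)) hB, boxCoeff_pairProd_succ, cutSum, sum_mul, map_sum]
  symm
  -- The terms with `p > k'` vanish: they exist only if `k' = k`, and then `gogFactor` has constant
  -- coefficient `0` at `p`.
  rw [← sum_subset (range_subset_range.2 (show k' + 1 ≤ n + 1 by omega))]
  · refine sum_congr rfl fun p hp => ?_
    have hp : p ≤ k' := Nat.lt_succ_iff.1 (mem_range.1 hp)
    rw [constantCoeff_gogFactor, if_pos (by omega), one_mul]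
    have hneg : ∀ q : MvPolynomial ℕ R, (-1 : MvPolynomial ℕ R) ^ p * q = ((-1 : R) ^ p) • q := by
      intro q
      rw [MvPolynomial.smul_eq_C_mul]; simp
    rw [mul_assoc, hneg, map_smul, smul_eq_mul]
    congr 1
    have e : (∏ i ∈ range p, ((1 + (1 - MvPolynomial.C v) * MvPolynomial.X i) *
          (1 + MvPolynomial.X i) ^ β i)) *
        ∏ i ∈ Ico p k', ((1 + MvPolynomial.C (us i) * MvPolynomial.X i) *
          (1 + MvPolynomial.X i) ^ β (i + 1)) =
        ∏ i ∈ range n, Polynomial.aeval (MvPolynomial.X i : MvPolynomial ℕ R)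
          (if i < k' then if i < p then
              (1 + (1 - Polynomial.C v) * Polynomial.X) * (1 + Polynomial.X) ^ β i else
              (1 + Polynomial.C (us i) * Polynomial.X) * (1 + Polynomial.X) ^ β (i + 1) else
            1 : Polynomial R) := by
      have e1 : ∀ i, Polynomial.aeval (MvPolynomial.X i : MvPolynomial ℕ R)
          (if i < k' then if i < p then
              (1 + (1 - Polynomial.C v) * Polynomial.X) * (1 + Polynomial.X) ^ β i else
              (1 + Polynomial.C (us i) * Polynomial.X) * (1 + Polynomial.X) ^ β (i + 1) else
            1 : Polynomial R) =
          if i < k' then if i < p then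
              (1 + (1 - MvPolynomial.C v) * MvPolynomial.X i) * (1 + MvPolynomial.X i) ^ β i else
              (1 + MvPolynomial.C (us i) * MvPolynomial.X i) *
                (1 + MvPolynomial.X i) ^ β (i + 1) else 1 := by
        intro i
        split_ifs <;> simp [MvPolynomial.algebraMap_eq]
      simp_rw [e1]
      rw [← hprod, ← prod_range_mul_prod_Ico _ hp]
      congr 1
      · exact prod_congr rfl fun i hi => (if_pos (mem_range.1 hi)).symm
      · exact prod_congr rfl fun i hi => (if_neg (not_lt.2 (mem_Ico.1 hi).1)).symm
    rw [e, boxCoeff_prod_aeval_mul]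
    refine LinearMap.congr_fun (boxCoeff_congr fun i hi => ?_) M
    by_cases hik : i < k'
    · by_cases hip : i < p
      · simp [hg, hik, hip, gogFactor, skip, hβdef, bottomSeq, show i < k by omega]
      · by_cases hik1 : i + 1 < k
        · simp [hg, hik, hip, gogFactor, skip, hβdef, bottomSeq, hik1, hus]
        -- Here the variable of index `k` moves into place `k - 1`. The new factor `1 + u x` cancels
        -- the inverse in `gogFactor`, leaving `(1 + x) ^ (m + k + 2)`; this dictates both `us (k -
        -- 1) = 0` and the last value of `bottomSeq`.
        · obtain rfl : k = i + 1 := by omega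
          simp only [hg, hik, hip, gogFactor, skip, hβdef, bottomSeq, hus, if_true, if_false,
            lt_irrefl]
          simp only [Nat.add_sub_cancel_left, Nat.sub_self, pow_one, pow_zero, mul_one]
          rw [mul_left_comm, onePlus_mul_inv]
          simp
    · simp [hg, hik, show ¬ i < p by omega, skip]
  · intro p hpn hp
    have hpn := mem_range.1 hpn
    have hp : ¬ p < k' + 1 := by simpa using hp
    rw [constantCoeff_gogFactor, if_neg (by omega), zero_mul, mul_zero]

/-! ### Removing and adding the bottom row of a trapezoid. -/

theorem entry_injective {m n k : ℕ} :
    Function.Injective (entry : GogTrapezoid m n k → ℕ → ℕ → ℕ) := by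
  rintro ⟨_, _, _, _, _, _, _⟩ ⟨_, _, _, _, _, _, _⟩ h
  cases h
  rfl

theorem isGogPos_iff_of_le {n k i j : ℕ} (hi : i ≤ n) :
    IsGogPos n (min k n) i j ↔ IsGogPos (n + 1) k i j := by
  unfold IsGogPos
  omega

/-- Removal of the bottom row. -/
def removeBottom {m n k : ℕ} (M : GogTrapezoid m (n + 1) k) :
    GogTrapezoid (m + 1) n (min k n) where
  entry i j := if i ≤ n then M.entry i j else 0
  entry_pos i j h := by
    have hi : i ≤ n := h.2.2.1
    rw [if_pos hi]
    exact M.entry_pos i j ((isGogPos_iff_of_le hi).1 h)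
  le_northEast i j h h' := by
    have hi : i + 1 ≤ n := h'.2.2.1
    rw [if_pos hi, if_pos (by omega)]
    exact M.le_northEast i j ((isGogPos_iff_of_le (by omega)).1 h) ((isGogPos_iff_of_le hi).1 h')
  le_southEast i j h h' := by
    have hi : i + 1 ≤ n := h'.2.2.1
    rw [if_pos hi, if_pos (by omega)]
    exact M.le_southEast i j ((isGogPos_iff_of_le (by omega)).1 h) ((isGogPos_iff_of_le hi).1 h')
  row_lt i j h h' := by
    have hi : i ≤ n := h.2.2.1
    rw [if_pos hi, if_pos hi]
    exact M.row_lt i j ((isGogPos_iff_of_le hi).1 h) ((isGogPos_iff_of_le hi).1 h')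
  le_bound i j h := by
    have hi : i ≤ n := h.2.2.1
    rw [if_pos hi]
    have := M.le_bound i j ((isGogPos_iff_of_le hi).1 h)
    omega
  zeros i j h := by
    split_ifs with hi
    · exact M.zeros i j (mt (isGogPos_iff_of_le hi).2 h)
    · rfl

/-- `a` can be the row above the bottom row `b`. -/
def IsAdmissibleRow (m n k : ℕ) (b : ℕ → ℕ) (a : Fin (min k n) → ℕ) : Prop :=
  StrictMono a ∧ ∀ i : Fin (min k n), bottomSeq m k b i ≤ a i ∧ a i ≤ bottomSeq m k b (i + 1) ∧
    (k ≤ i + 1 → a i < bottomSeq m k b (i + 1))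

/-- `b` satisfies the conditions on bottom rows of `(m, n, k)`-Gog trapezoids. -/
structure IsBottomRow (m k : ℕ) (b : ℕ → ℕ) : Prop where
  pos : ∀ i ∈ Icc 1 k, 1 ≤ b i
  strict : ∀ i ∈ Icc 1 k, ∀ j ∈ Icc 1 k, i < j → b i < b j
  bound : ∀ i ∈ Icc 1 k, b i ≤ m + i

theorem IsBottomRow.bottomSeq_lt {m k : ℕ} {b : ℕ → ℕ} (hb : IsBottomRow m k b) {i : ℕ}
    (hi : i < k) : bottomSeq m k b i < bottomSeq m k b (i + 1) := by
  rw [bottomSeq, bottomSeq, if_pos hi]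
  split_ifs with h
  · exact hb.strict _ (mem_Icc.2 ⟨by omega, by omega⟩) _ (mem_Icc.2 ⟨by omega, by omega⟩) (by omega)
  · have := hb.bound (i + 1) (mem_Icc.2 ⟨by omega, by omega⟩)
    omega

theorem IsBottomRow.bottomSeq_le {m k : ℕ} {b : ℕ → ℕ} (hb : IsBottomRow m k b) (i : ℕ) :
    bottomSeq m k b i ≤ m + k + 2 := by
  rw [bottomSeq]
  split_ifs with h
  · have := hb.bound (i + 1) (mem_Icc.2 ⟨by omega, by omega⟩)
    omega
  · rfl

theorem IsBottomRow.bottomSeq_le' {m k : ℕ} {b : ℕ → ℕ} (hb : IsBottomRow m k b) {i : ℕ}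
    (hi : i < k) : bottomSeq m k b i ≤ m + i + 1 := by
  rw [bottomSeq, if_pos hi]
  have := hb.bound (i + 1) (mem_Icc.2 ⟨by omega, by omega⟩)
  omega

theorem IsAdmissibleRow.isBottomRow {m n k : ℕ} {b : ℕ → ℕ} (hb : IsBottomRow m k b)
    {a : Fin (min k n) → ℕ} (ha : IsAdmissibleRow m n k b a) :
    IsBottomRow (m + 1) (min k n) (rowFun a) := by
  have hf : ∀ i ∈ Icc 1 (min k n), ∃ i' : Fin (min k n), i = i' + 1 ∧ rowFun a i = a i' := by
    intro i hi
    obtain ⟨h1, h2⟩ := mem_Icc.1 hi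
    refine ⟨⟨i - 1, by omega⟩, by simp; omega, ?_⟩
    rw [rowFun, dif_pos ⟨h1, h2⟩]
  refine ⟨fun i hi => ?_, fun i hi j hj hij => ?_, fun i hi => ?_⟩
  · obtain ⟨i', rfl, h⟩ := hf i hi
    rw [h]
    have h1 := (ha.2 i').1
    have h2 := i'.2
    rw [bottomSeq, if_pos (by omega)] at h1
    exact (hb.pos _ (mem_Icc.2 ⟨by omega, by omega⟩)).trans h1
  · obtain ⟨i', rfl, h⟩ := hf i hi
    obtain ⟨j', rfl, h'⟩ := hf j hj
    rw [h, h']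
    exact ha.1 (Fin.lt_def.2 (by omega))
  · obtain ⟨i', rfl, h⟩ := hf i hi
    rw [h]
    obtain ⟨-, h2, h3⟩ := ha.2 i'
    have := i'.2
    by_cases hk : (i' : ℕ) + 1 < k
    · have := hb.bottomSeq_le' hk
      omega
    · have := h3 (by omega)
      rw [bottomSeq, if_neg hk] at this
      omega

/-- Addition of the bottom row `b` below the row `a`. -/
def addBottom {m n k : ℕ} {b : ℕ → ℕ} (hb : IsBottomRow m k b) {a : Fin (min k n) → ℕ}
    (ha : IsAdmissibleRow m n k b a) (M : GogTrapezoid (m + 1) n (min k n))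
    (hM : M.HasBottomRow (rowFun a)) (hk : k ≤ n + 1) : GogTrapezoid m (n + 1) k :=
  have hrow : ∀ j, 1 ≤ j → j ≤ min k n → ∃ i : Fin (min k n), j = i + 1 ∧ M.entry n j = a i := by
    intro j h1 h2
    refine ⟨⟨j - 1, by omega⟩, by simp; omega, ?_⟩
    rw [hM j (mem_Icc.2 ⟨h1, h2⟩), rowFun, dif_pos ⟨h1, h2⟩]
  { entry := fun i j => if i = n + 1 then (if 1 ≤ j ∧ j ≤ k then b j else 0) else M.entry i j
    entry_pos := by
      intro i j h
      split_ifs with h1 h2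
      · exact hb.pos j (mem_Icc.2 h2)
      · exact absurd ⟨h.1, h.2.2.2⟩ h2
      · have := h.2.2.1
        exact M.entry_pos i j ((isGogPos_iff_of_le (by omega)).2 h)
    le_northEast := by
      intro i j h h'
      have hi : i + 1 ≤ n + 1 := h'.2.2.1
      rw [if_neg (show ¬ i = n + 1 by omega)]
      split_ifs with h1 h2
      · obtain rfl : i = n := by omega
        obtain ⟨j', rfl, e⟩ := hrow j h2.1 (le_min h2.2 h.2.1)
        rw [e]
        have := (ha.2 j').1
        rwa [bottomSeq, if_pos (by omega)] at this
      · exact Nat.zero_le _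
      · exact M.le_northEast i j ((isGogPos_iff_of_le (by omega)).2 h)
          ((isGogPos_iff_of_le (by omega)).2 h')
    le_southEast := by
      intro i j h h'
      have hi : i + 1 ≤ n + 1 := h'.2.2.1
      rw [if_neg (show ¬ i = n + 1 by omega)]
      split_ifs with h1 h2
      · obtain rfl : i = n := by omega
        obtain ⟨j', rfl, e⟩ := hrow j h.1 (le_min h.2.2.2 h.2.1)
        rw [e]
        have := (ha.2 j').2.1
        rwa [bottomSeq, if_pos (by omega)] at this
      · exact absurd ⟨h'.1, h'.2.2.2⟩ h2
      · exact M.le_southEast i j ((isGogPos_iff_of_le (by omega)).2 h)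
          ((isGogPos_iff_of_le (by omega)).2 h')
    row_lt := by
      intro i j h h'
      have hi : i ≤ n + 1 := h.2.2.1
      by_cases h1 : i = n + 1
      · have h2 := h'.2.2.2
        have h3 := h.1
        rw [if_pos h1, if_pos h1, if_pos ⟨h3, by omega⟩, if_pos ⟨by omega, h2⟩]
        exact hb.strict _ (mem_Icc.2 ⟨h3, by omega⟩) _ (mem_Icc.2 ⟨by omega, h2⟩) (by omega)
      · rw [if_neg h1, if_neg h1]
        exact M.row_lt i j ((isGogPos_iff_of_le (by omega)).2 h)
          ((isGogPos_iff_of_le (by omega)).2 h')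
    le_bound := by
      intro i j h
      have hi : i ≤ n + 1 := h.2.2.1
      split_ifs with h1 h2
      · have := hb.bound j (mem_Icc.2 h2)
        omega
      · exact Nat.zero_le _
      · have := M.le_bound i j ((isGogPos_iff_of_le (by omega)).2 h)
        omega
    zeros := by
      intro i j h
      split_ifs with h1 h2
      · exact absurd ⟨h2.1, by omega, by omega, h2.2⟩ h
      · rfl
      · by_cases hi : i ≤ n
        · exact M.zeros i j (mt (isGogPos_iff_of_le hi).1 h)
        · exact M.zeros i j (fun h' => hi h'.2.2.1) }

/-- The row above the bottom row. -/
def nextRow {m n k : ℕ} (M : GogTrapezoid m (n + 1) k) : Fin (min k n) → ℕ :=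
  fun i => M.entry n (i + 1)

theorem entry_lt_entry {m n k : ℕ} (M : GogTrapezoid m n k) {i j : ℕ} (hj : IsGogPos n k i j)
    (d : ℕ) (hd : IsGogPos n k i (j + d + 1)) : M.entry i j < M.entry i (j + d + 1) := by
  induction d with
  | zero => exact M.row_lt i j hj hd
  | succ d ih =>
    have h : IsGogPos n k i (j + d + 1) :=
      ⟨by omega, by have := hd.2.1; omega, hd.2.2.1, by have := hd.2.2.2; omega⟩
    exact (ih h).trans (M.row_lt i _ h hd)

theorem isAdmissibleRow_nextRow {m n k : ℕ} {b : ℕ → ℕ} (M : GogTrapezoid m (n + 1) k)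
    (hM : M.HasBottomRow b) (hk : k ≤ n + 1) : IsAdmissibleRow m n k b M.nextRow := by
  have hpos : ∀ i : Fin (min k n), IsGogPos (n + 1) k n (i + 1) := fun i =>
    ⟨by omega, by have := i.2; omega, by omega, by have := i.2; omega⟩
  refine ⟨fun i j hij => ?_, fun i => ⟨?_, ?_, ?_⟩⟩
  · have hij : (i : ℕ) < j := hij
    have e : (j : ℕ) + 1 = (i + 1) + (j - i - 1) + 1 := by omega
    have h := hpos j
    rw [e] at h
    have := M.entry_lt_entry (hpos i) _ h
    rwa [← e] at this
  · have hik : (i : ℕ) < k := by have := i.2; omega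
    have hp : IsGogPos (n + 1) k (n + 1) (i + 1) := ⟨by omega, by omega, le_rfl, by omega⟩
    rw [bottomSeq, if_pos hik, ← hM _ (mem_Icc.2 ⟨by omega, by omega⟩)]
    exact M.le_northEast n _ (hpos i) hp
  · rw [bottomSeq]
    split_ifs with hik
    · have hp : IsGogPos (n + 1) k (n + 1) (i + 1 + 1) := ⟨by omega, by omega, le_rfl, by omega⟩
      rw [← hM _ (mem_Icc.2 ⟨by omega, by omega⟩)]
      exact M.le_southEast n _ (hpos i) hp
    · have h1 := M.le_bound n _ (hpos i)
      have h2 := i.2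
      rw [nextRow]
      omega
  · intro h
    have h1 := M.le_bound n _ (hpos i)
    have h2 := i.2
    rw [bottomSeq, if_neg (by omega), nextRow]
    omega

/-- The entry above the last diagonal is at most `m + k + 1`, one less than the end value `m + k +
2` of `bottomSeq`. At that end value the weight is `us (k - 1) = 0`, so exactly the admissible rows
remain possible. -/
theorem rowWeight_eq_zero (u v : R) {m n k : ℕ} {b : ℕ → ℕ} (hb : IsBottomRow m k b)
    {a : Fin (min k n) → ℕ} (ha : ¬ IsAdmissibleRow m n k b a) :
    rowWeight (entryWeight (bottomSeq m k b) (fun i => if i + 1 < k then u else 0) v) a = 0 := by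
  by_contra h
  obtain ⟨h1, h2⟩ := bounds_of_rowWeight_ne_zero (β := bottomSeq m k b) (fun i hi => hb.bottomSeq_lt (by omega)) h
  refine ha ⟨h1, fun i => ⟨(h2 i).1, (h2 i).2, fun hk => lt_of_le_of_ne (h2 i).2 fun he => h ?_⟩⟩
  have hlt : bottomSeq m k b i < bottomSeq m k b (i + 1) :=
    hb.bottomSeq_lt (by have := i.2; omega)
  rw [rowWeight, prod_eq_zero (mem_univ i), zero_mul]
  rw [entryWeight, if_neg (by omega), if_pos he, if_neg (by omega)]

theorem rowWeight_eq_prod (u v : R) {m n k : ℕ} {b : ℕ → ℕ} (hb : IsBottomRow m k b)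
    {a : Fin (min k n) → ℕ} (ha : IsAdmissibleRow m n k b a) :
    rowWeight (entryWeight (bottomSeq m k b) (fun i => if i + 1 < k then u else 0) v) a =
      ∏ i : Fin (min k n), ((if (i : ℕ) + 1 < k ∧ a i = b (i + 2) then u else 1) *
        (if a i = b (i + 1) then v else 1)) := by
  rw [rowWeight, if_pos ha.1, mul_one]
  refine prod_congr rfl fun i _ => ?_
  obtain ⟨h1, h2, h3⟩ := ha.2 i
  have hik : (i : ℕ) < k := by have := i.2; omega
  have hlt : bottomSeq m k b i < bottomSeq m k b (i + 1) := hb.bottomSeq_lt hik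
  have e : bottomSeq m k b i = b (i + 1) := if_pos hik
  by_cases hk : (i : ℕ) + 1 < k
  · have e' : bottomSeq m k b (i + 1) = b (i + 2) := if_pos hk
    rw [e, e'] at hlt
    rw [e] at h1
    rw [e'] at h2
    simp only [entryWeight, e, e', hk, true_and, if_true]
    split_ifs <;> first | omega | simp
  · have h3 := h3 (by omega)
    rw [e] at hlt h1
    simp only [entryWeight, e, hk, false_and, if_false, one_mul]
    split_ifs <;> first | omega | simp

/-- The index set `S` is left free so that a trapezoid and its truncation can be compared factor by
factor over one set. -/
theorem pow_inv_eq_prod (u : R) {m n k : ℕ} (M : GogTrapezoid m n k) (S : Finset (ℕ × ℕ))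
    (hS : ∀ i j, IsGogPos n k i j → IsGogPos n k (i + 1) (j + 1) → (i, j) ∈ S) :
    u ^ M.inv = ∏ p ∈ S, if IsGogPos n k p.1 p.2 ∧ IsGogPos n k (p.1 + 1) (p.2 + 1) ∧
      M.entry p.1 p.2 = M.entry (p.1 + 1) (p.2 + 1) then u else 1 := by
  rw [← prod_filter, prod_const, inv]
  congr 2
  ext ⟨i, j⟩
  simp only [mem_filter, mem_product, mem_Icc]
  constructor
  · rintro ⟨-, h⟩
    exact ⟨hS i j h.1 h.2.1, h⟩
  · rintro ⟨-, h⟩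
    refine ⟨?_, h⟩
    obtain ⟨⟨_, _, _, _⟩, _⟩ := h
    omega

theorem pow_inv'_eq_prod (v : R) {m n k : ℕ} (M : GogTrapezoid m n k) (S : Finset (ℕ × ℕ))
    (hS : ∀ i j, IsGogPos n k i j → IsGogPos n k (i + 1) j → (i, j) ∈ S) :
    v ^ M.inv' = ∏ p ∈ S, if IsGogPos n k p.1 p.2 ∧ IsGogPos n k (p.1 + 1) p.2 ∧
      M.entry p.1 p.2 = M.entry (p.1 + 1) p.2 then v else 1 := by
  rw [← prod_filter, prod_const, inv']
  congr 2
  ext ⟨i, j⟩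
  simp only [mem_filter, mem_product, mem_Icc]
  constructor
  · rintro ⟨-, h⟩
    exact ⟨hS i j h.1 h.2.1, h⟩
  · rintro ⟨-, h⟩
    refine ⟨?_, h⟩
    obtain ⟨⟨_, _, _, _⟩, _⟩ := h
    omega

theorem prod_ite_last_row (c : R) {n k' : ℕ} (hk : k' ≤ n) (Q : ℕ → Prop) [DecidablePred Q] :
    ∏ p ∈ Icc 1 n ×ˢ Icc 1 k', (if p.1 = n ∧ Q p.2 then c else 1) =
      ∏ i : Fin k', if Q (i + 1) then c else 1 := by
  have h1 : ∏ i : Fin k', (if Q (i + 1) then c else 1) = ∏ j ∈ Icc 1 k', if Q j then c else 1 := by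
    rw [← prod_range (fun i => if Q (i + 1) then c else 1)]
    refine prod_nbij' (fun i => i + 1) (fun i => i - 1) ?_ ?_ ?_ ?_ ?_
    · intro i hi; have := mem_range.1 hi; exact mem_Icc.2 ⟨by omega, by omega⟩
    · intro i hi; have := mem_Icc.1 hi; exact mem_range.2 (by omega)
    · intro i _; rfl
    · intro i hi; have := mem_Icc.1 hi; omega
    · intro i _; rfl
  rw [h1, prod_product_right]
  refine prod_congr rfl fun j hj => ?_
  have hj := mem_Icc.1 hj
  rw [prod_eq_single n]
  · simp
  · intro i _ hi; simp [hi]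
  · intro h; exact absurd (mem_Icc.2 ⟨by omega, le_rfl⟩) h

/-- Equalities between the last two rows make up the row weight; all others are equalities within
the truncated trapezoid. -/
theorem pow_inv_removeBottom (u v : R) {m n k : ℕ} {b : ℕ → ℕ} (hb : IsBottomRow m k b)
    (hk : k ≤ n + 1) (M : GogTrapezoid m (n + 1) k) (hM : M.HasBottomRow b) :
    u ^ M.inv * v ^ M.inv' =
      rowWeight (entryWeight (bottomSeq m k b) (fun i => if i + 1 < k then u else 0) v) M.nextRow *
        (u ^ M.removeBottom.inv * v ^ M.removeBottom.inv') := by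
  rw [rowWeight_eq_prod u v hb (M.isAdmissibleRow_nextRow hM hk), prod_mul_distrib]
  have hu : u ^ M.inv = (∏ i : Fin (min k n),
      if (i : ℕ) + 1 < k ∧ M.nextRow i = b (i + 2) then u else 1) * u ^ M.removeBottom.inv := by
    rw [pow_inv_eq_prod u M (Icc 1 n ×ˢ Icc 1 (min k n)),
      pow_inv_eq_prod u M.removeBottom (Icc 1 n ×ˢ Icc 1 (min k n))]
    · have := prod_ite_last_row u (min_le_right k n) (fun j => j < k ∧ M.entry n j = b (j + 1))
      have e : (∏ i : Fin (min k n), if (i : ℕ) + 1 < k ∧ M.nextRow i = b (i + 2) then u else 1) =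
        _ := this.symm
      rw [e, ← prod_mul_distrib]
      refine prod_congr rfl ?_
      rintro ⟨i, j⟩ hp
      simp only [mem_product, mem_Icc] at hp ⊢
      rcases eq_or_lt_of_le hp.1.2 with rfl | hi
      · have h0 : ¬ IsGogPos i (min k i) (i + 1) (j + 1) := fun h => by have := h.2.2.1; omega
        have h1 : IsGogPos (i + 1) k i j := ⟨by omega, by omega, by omega, by omega⟩
        have h2 : IsGogPos (i + 1) k (i + 1) (j + 1) ↔ j < k :=
          ⟨fun h => h.2.2.2, fun h => ⟨by omega, by omega, le_rfl, h⟩⟩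
        by_cases hj : j < k
        · rw [hM (j + 1) (mem_Icc.2 ⟨by omega, by omega⟩)]
          simp [h0, h1, h2]
        · simp [h0, h1, h2, hj]
      · simp [isGogPos_iff_of_le hi.le, isGogPos_iff_of_le (Nat.succ_le_of_lt hi), removeBottom,
          hi.ne, hi.le, Nat.succ_le_of_lt hi]
    · rintro i j ⟨_, _, _, _⟩ ⟨_, _, _, _⟩
      simp only [mem_product, mem_Icc]
      omega
    · rintro i j ⟨_, _, _, _⟩ ⟨_, _, _, _⟩
      simp only [mem_product, mem_Icc]
      omega
  have hv : v ^ M.inv' = (∏ i : Fin (min k n),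
      if M.nextRow i = b (i + 1) then v else 1) * v ^ M.removeBottom.inv' := by
    rw [pow_inv'_eq_prod v M (Icc 1 n ×ˢ Icc 1 (min k n)),
      pow_inv'_eq_prod v M.removeBottom (Icc 1 n ×ˢ Icc 1 (min k n))]
    · have := prod_ite_last_row v (min_le_right k n) (fun j => M.entry n j = b j)
      have e : (∏ i : Fin (min k n), if M.nextRow i = b (i + 1) then v else 1) = _ := this.symm
      rw [e, ← prod_mul_distrib]
      refine prod_congr rfl ?_
      rintro ⟨i, j⟩ hp
      simp only [mem_product, mem_Icc] at hp ⊢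
      rcases eq_or_lt_of_le hp.1.2 with rfl | hi
      · have h0 : ¬ IsGogPos i (min k i) (i + 1) j := fun h => by have := h.2.2.1; omega
        have h1 : IsGogPos (i + 1) k i j := ⟨by omega, by omega, by omega, by omega⟩
        have h2 : IsGogPos (i + 1) k (i + 1) j := ⟨by omega, by omega, by omega, by omega⟩
        rw [hM j (mem_Icc.2 ⟨by omega, by omega⟩)]
        simp [h0, h1, h2]
      · simp [isGogPos_iff_of_le hi.le, isGogPos_iff_of_le (Nat.succ_le_of_lt hi), removeBottom,
          hi.ne, hi.le, Nat.succ_le_of_lt hi]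
    · rintro i j ⟨_, _, _, _⟩ ⟨_, _, _, _⟩
      simp only [mem_product, mem_Icc]
      omega
    · rintro i j ⟨_, _, _, _⟩ ⟨_, _, _, _⟩
      simp only [mem_product, mem_Icc]
      omega
  rw [hu, hv]
  ring

/-- Trapezoids are grouped by the row above the bottom one. The fibre over an admissible row is in
bijection with the smaller trapezoids ending in that row, and the fibre over any other row is empty.
-/
theorem gogGenFun_succ (u v : R) {m n k : ℕ} {b : ℕ → ℕ} (hb : IsBottomRow m k b)
    (hk : k ≤ n + 1) {B : ℕ} (hB : m + k + 2 < B) :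
    gogGenFun m (n + 1) k b u v = ∑ a ∈ Fintype.piFinset fun _ : Fin (min k n) => range B,
      rowWeight (entryWeight (bottomSeq m k b) (fun i => if i + 1 < k then u else 0) v) a *
        gogGenFun (m + 1) n (min k n) (rowFun a) u v := by
  classical
  rw [gogGenFun, ← sum_fiberwise_of_maps_to
    (t := Fintype.piFinset fun _ : Fin (min k n) => range B) (g := fun M => M.1.nextRow)]
  swap
  · rintro ⟨M, hM⟩ -
    rw [Fintype.mem_piFinset]
    intro i
    have h1 := (M.isAdmissibleRow_nextRow hM hk).2 i
    have h2 := hb.bottomSeq_le (i + 1)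
    exact mem_range.2 (show M.nextRow i < B by omega)
  refine sum_congr rfl fun a _ => ?_
  by_cases ha : IsAdmissibleRow m n k b a
  · rw [gogGenFun, mul_sum]
    have hrem : ∀ M : GogTrapezoid m (n + 1) k, M.nextRow = a →
        M.removeBottom.HasBottomRow (rowFun a) := by
      rintro M rfl j hj
      obtain ⟨h1, h2⟩ := mem_Icc.1 hj
      rw [rowFun, dif_pos ⟨h1, h2⟩]
      simp [removeBottom, nextRow, Nat.sub_add_cancel h1]
    have hadd : ∀ (M : GogTrapezoid (m + 1) n (min k n)) (hM : M.HasBottomRow (rowFun a)),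
        (addBottom hb ha M hM hk).HasBottomRow b ∧ (addBottom hb ha M hM hk).nextRow = a := by
      intro M hM
      refine ⟨fun j hj => ?_, ?_⟩
      · simp [addBottom, mem_Icc.1 hj]
      · funext i
        have : M.entry n (i + 1) = rowFun a (i + 1) :=
          hM (i + 1) (mem_Icc.2 ⟨by omega, by have := i.2; omega⟩)
        rw [rowFun_succ a i.2] at this
        simp [nextRow, addBottom, this]
    refine sum_bij' (fun M hM => ⟨M.1.removeBottom, hrem M.1 (mem_filter.1 hM).2⟩)
      (fun M _ => ⟨addBottom hb ha M.1 M.2 hk, (hadd M.1 M.2).1⟩) ?_ ?_ ?_ ?_ ?_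
    · intro M _; exact mem_univ _
    · intro M _; exact mem_filter.2 ⟨mem_univ _, (hadd M.1 M.2).2⟩
    · rintro ⟨M, hM⟩ _
      refine Subtype.ext (entry_injective ?_)
      funext i j
      simp only [addBottom, removeBottom]
      by_cases hi : i = n + 1
      · subst hi
        rw [if_pos rfl]
        split_ifs with hj
        · exact (hM j (mem_Icc.2 hj)).symm
        · exact (M.zeros _ _ fun h => hj ⟨h.1, h.2.2.2⟩).symm
      · rw [if_neg hi]
        split_ifs with hin
        · rfl
        · exact (M.zeros _ _ fun h => by have := h.2.2.1; omega).symm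
    · rintro ⟨M, hM⟩ _
      refine Subtype.ext (entry_injective ?_)
      funext i j
      simp only [addBottom, removeBottom]
      split_ifs with h1 h2 h3
      · omega
      · omega
      · rfl
      · exact (M.zeros _ _ fun h => h1 h.2.2.1).symm
    · rintro ⟨M, hM⟩ h
      obtain rfl := (mem_filter.1 h).2
      exact pow_inv_removeBottom u v hb hk M hM
  · rw [rowWeight_eq_zero u v hb ha, zero_mul]
    refine sum_eq_zero ?_
    rintro ⟨M, hM⟩ h
    obtain rfl := (mem_filter.1 h).2
    exact absurd (M.isAdmissibleRow_nextRow hM hk) ha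

/-! ### Translation of the Laurent series and the final induction. -/

theorem prod_Icc_succ_eq_prod_Ico {M : Type*} [CommMonoid M] (a n : ℕ) (F : ℕ → M) :
    ∏ i ∈ Icc (a + 1) n, F i = ∏ i ∈ Ico a n, F (i + 1) := by
  symm
  refine prod_nbij' (fun i => i + 1) (fun i => i - 1) ?_ ?_ ?_ ?_ ?_
  · intro i hi; have := mem_Ico.1 hi; exact mem_Icc.2 ⟨by omega, by omega⟩
  · intro i hi; have := mem_Icc.1 hi; exact mem_Ico.2 ⟨by omega, by omega⟩
  · intro i _; rfl
  · intro i hi; have := mem_Icc.1 hi; omega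
  · intro i _; rfl

theorem onePlus_zpow_neg {σ : Type*} (u : R) (s : σ) (d : ℕ) :
    ((onePlus u s ^ (-(d : ℤ)) : (MvLaurentSeries σ R)ˣ) : MvLaurentSeries σ R) =
      ofPowerSeriesAt s (((onePlusUnit u)⁻¹ : (PowerSeries R)ˣ).val ^ d) := by
  rw [zpow_neg, zpow_natCast, ← inv_pow, onePlus, ← map_inv, ← map_pow, Units.coe_map,
    Units.val_pow_eq_pow_val]
  rfl

/-- The separate factor `x_{i+1}` comes from `∏ x_i` in the argument of `boxCoeff`; it turns the
uniform exponent `-n` into the exponents of `gogLaurentSeries`. -/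
theorem varX_zpow_mul_gogFactor (m n k : ℕ) (b : ℕ → ℕ) (u : R) (i : ℕ) :
    ((varX (i + 1) ^ (-(n : ℤ)) : (MvLaurentSeries ℕ R)ˣ) : MvLaurentSeries ℕ R) *
        ofPowerSeriesAt (i + 1) (gogFactor m k b u i) *
        ((varX (i + 1) : (MvLaurentSeries ℕ R)ˣ) : MvLaurentSeries ℕ R) =
      if i < k then (1 + ((varX (i + 1) : (MvLaurentSeries ℕ R)ˣ) : MvLaurentSeries ℕ R)) ^
          b (i + 1) *
          ((varX (i + 1) ^ (-(n : ℤ) + 1) : (MvLaurentSeries ℕ R)ˣ) : MvLaurentSeries ℕ R)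
      else (1 + ((varX (i + 1) : (MvLaurentSeries ℕ R)ˣ) : MvLaurentSeries ℕ R)) ^
          (m + (i + 1) + 1) *
          ((onePlus u (i + 1) ^ ((k : ℤ) - (i + 1 : ℕ)) : (MvLaurentSeries ℕ R)ˣ) :
            MvLaurentSeries ℕ R) *
          ((varX (i + 1) ^ (-(n : ℤ) + (i + 1 : ℕ) - k) : (MvLaurentSeries ℕ R)ˣ) :
            MvLaurentSeries ℕ R) := by
  split_ifs with h
  · rw [gogFactor, if_pos h, map_pow, map_add, map_one, ofPowerSeriesAt_X, zpow_add, zpow_one,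
      Units.val_mul]
    ring
  · have e1 : (k : ℤ) - (i + 1 : ℕ) = -((i + 1 - k : ℕ) : ℤ) := by omega
    have e2 : -(n : ℤ) + (i + 1 : ℕ) - k = -(n : ℤ) + (i - k : ℕ) + 1 := by omega
    rw [gogFactor, if_neg h, map_mul, map_mul, map_pow _ (1 + _), map_pow _ PowerSeries.X, map_add,
      map_one, ofPowerSeriesAt_X, e1, onePlus_zpow_neg, e2, zpow_add, zpow_add, zpow_one,
      zpow_natCast, Units.val_mul, Units.val_mul, Units.val_pow_eq_pow_val]
    ring

theorem toLaurent_X {n i : ℕ} (hi : i < n) :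
    toLaurent R n (MvPolynomial.X i) = (varX (i + 1) : (MvLaurentSeries ℕ R)ˣ) := by
  rw [toLaurent, MvPolynomial.aeval_X, if_pos hi]

theorem toLaurent_C (n : ℕ) (c : R) : toLaurent R n (MvPolynomial.C c) = HahnSeries.C c := by
  rw [toLaurent, MvPolynomial.aeval_C, HahnSeries.algebraMap_apply]
  rfl

theorem toLaurent_pairProd (n : ℕ) (u v : R) :
    toLaurent R n (pairProd n u v) = ∏ i ∈ Icc 1 n, ∏ j ∈ Icc (i + 1) n,
      (((varX i : (MvLaurentSeries ℕ R)ˣ) : MvLaurentSeries ℕ R) -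
          ((varX j : (MvLaurentSeries ℕ R)ˣ) : MvLaurentSeries ℕ R)) *
        (1 + (1 - HahnSeries.C v) * ((varX i : (MvLaurentSeries ℕ R)ˣ) : MvLaurentSeries ℕ R) +
          HahnSeries.C u * (((varX j : (MvLaurentSeries ℕ R)ˣ) : MvLaurentSeries ℕ R) +
            ((varX i : (MvLaurentSeries ℕ R)ˣ) : MvLaurentSeries ℕ R) *
            ((varX j : (MvLaurentSeries ℕ R)ˣ) : MvLaurentSeries ℕ R))) := by
  rw [prod_Icc_succ_eq_prod_Ico 0 n]
  simp_rw [prod_Icc_succ_eq_prod_Ico]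
  rw [prod_comm' (t' := range n) (s' := fun j => range j)]
  · rw [pairProd]
    simp_rw [map_prod]
    refine prod_congr rfl fun j hj => prod_congr rfl fun i hi => ?_
    have hj := mem_range.1 hj
    have hi := mem_range.1 hi
    simp only [pairFactor, map_mul, map_sub, map_add, map_one, toLaurent_C, toLaurent_X hj,
      toLaurent_X (hi.trans hj)]
  · intro i j
    simp only [mem_Ico, mem_range]
    omega

theorem prod_varX_zpow_mul_gogFactor (u : R) {m n k : ℕ} (hk : k ≤ n) (b : ℕ → ℕ) :
    ∏ i ∈ range n, (((varX (i + 1) ^ (-(n : ℤ)) : (MvLaurentSeries ℕ R)ˣ) : MvLaurentSeries ℕ R) *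
        ofPowerSeriesAt (i + 1) (gogFactor m k b u i) * toLaurent R n (MvPolynomial.X i)) =
      (∏ i ∈ Icc 1 k, (1 + ((varX i : (MvLaurentSeries ℕ R)ˣ) : MvLaurentSeries ℕ R)) ^ b i *
        ((varX i ^ (-(n : ℤ) + 1) : (MvLaurentSeries ℕ R)ˣ) : MvLaurentSeries ℕ R)) *
      ∏ i ∈ Icc (k + 1) n,
        (1 + ((varX i : (MvLaurentSeries ℕ R)ˣ) : MvLaurentSeries ℕ R)) ^ (m + i + 1) *
          ((onePlus u i ^ ((k : ℤ) - i) : (MvLaurentSeries ℕ R)ˣ) : MvLaurentSeries ℕ R) *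
          ((varX i ^ (-(n : ℤ) + i - k) : (MvLaurentSeries ℕ R)ˣ) : MvLaurentSeries ℕ R) := by
  rw [prod_Icc_succ_eq_prod_Ico 0 k, prod_Icc_succ_eq_prod_Ico k n,
    ← prod_range_mul_prod_Ico _ hk, ← range_eq_Ico]
  refine congrArg₂ (· * ·) (prod_congr rfl fun i hi => ?_) (prod_congr rfl fun i hi => ?_)
  · have hi := mem_range.1 hi
    rw [toLaurent_X (by omega), varX_zpow_mul_gogFactor, if_pos hi]
  · have hi := mem_Ico.1 hi
    rw [toLaurent_X hi.2, varX_zpow_mul_gogFactor, if_neg (by omega)]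

theorem constantTerm_gogLaurentSeries (u v : R) {m n k : ℕ} (hk : k ≤ n) (b : ℕ → ℕ) :
    (gogLaurentSeries m n k b u v).constantTerm =
      boxCoeff n n (gogFactor m k b u) ((∏ i ∈ range n, MvPolynomial.X i) * pairProd n u v) := by
  rw [boxCoeff_eq_constantTerm, map_mul, map_prod, ← mul_assoc, ← prod_mul_distrib,
    prod_varX_zpow_mul_gogFactor u hk b, toLaurent_pairProd]
  rfl

theorem gogGenFun_zero (u v : R) (m : ℕ) (b : ℕ → ℕ) : gogGenFun m 0 0 b u v = 1 := by
  have hpos : ∀ i j, ¬ IsGogPos 0 0 i j := fun i j h => by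
    obtain ⟨_, _, _, _⟩ := h
    omega
  let M₀ : GogTrapezoid m 0 0 :=
    { entry := fun _ _ => 0
      entry_pos := fun i j h => absurd h (hpos i j)
      le_northEast := fun i j h => absurd h (hpos i j)
      le_southEast := fun i j h => absurd h (hpos i j)
      row_lt := fun i j h => absurd h (hpos i j)
      le_bound := fun i j h => absurd h (hpos i j)
      zeros := fun _ _ _ => rfl }
  have h₀ : M₀.HasBottomRow b := fun j hj => by simp at hj
  rw [gogGenFun, Fintype.sum_eq_single ⟨M₀, h₀⟩]
  · simp [inv, inv']
  · rintro ⟨M, hM⟩ hne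
    refine absurd (Subtype.ext (entry_injective ?_)) hne
    funext i j
    exact M.zeros i j (hpos i j)

theorem gogGenFun_eq_boxCoeff (u v : R) {m n k : ℕ} (hk : k ≤ n) {b : ℕ → ℕ}
    (hb : IsBottomRow m k b) :
    gogGenFun m n k b u v =
      boxCoeff n n (gogFactor m k b u) ((∏ i ∈ range n, MvPolynomial.X i) * pairProd n u v) := by
  induction n generalizing m k b with
  | zero =>
    obtain rfl := Nat.le_zero.1 hk
    have : ((∏ i ∈ range 0, MvPolynomial.X i) * pairProd 0 u v : MvPolynomial ℕ R) =
        MvPolynomial.monomial 0 1 := by simp [pairProd]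
    rw [gogGenFun_zero, this, boxCoeff_monomial]
    simp
  | succ n ih =>
    rw [gogGenFun_succ u v hb hk (Nat.lt_succ_self _),
      boxCoeff_gogFactor_succ u v hk b (fun i hi => hb.bottomSeq_lt (by omega))
        (fun i _ => Nat.lt_succ_of_le (hb.bottomSeq_le _))]
    refine sum_congr rfl fun a _ => ?_
    -- The induction hypothesis needs a valid bottom row; all other rows have weight `0` on both
    -- sides.
    by_cases ha : IsAdmissibleRow m n k b a
    · rw [ih (min_le_right k n) (ha.isBottomRow hb)]
    · rw [rowWeight_eq_zero u v hb ha, zero_mul, zero_mul]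

end GogTrapezoid

theorem mainTheorem6 {R : Type*} [CommRing R] (u v : R) (m n k : ℕ) (hkn : k ≤ n)
    (b : ℕ → ℕ) (hb_pos : ∀ i ∈ Finset.Icc 1 k, 1 ≤ b i)
    (hb_strict : ∀ i ∈ Finset.Icc 1 k, ∀ j ∈ Finset.Icc 1 k, i < j → b i < b j)
    (hb_bound : ∀ i ∈ Finset.Icc 1 k, b i ≤ m + i) :
    gogGenFun m n k b u v = (gogLaurentSeries m n k b u v).constantTerm := by
  rw [GogTrapezoid.constantTerm_gogLaurentSeries u v hkn,
    GogTrapezoid.gogGenFun_eq_boxCoeff u v hkn ⟨hb_pos, hb_strict, hb_bound⟩]
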